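/- Let $K$ be a field. A $K$-category is a category whose morphism sets are $K$-vector spaces with bilinear composition; it is Hom-finite if all $\mathcal C(X,Y)$ are finite dimensional, and Krull–Schmidt if it is additive and every object is a finite direct sum of indecomposable objects with local endomorphism rings. A $\mathcal C$-module is an additive covariant functor from $\mathcal C$ to abelian groups. For a full additive subcategory $\mathcal B$ of $\mathcal C$ let $I_{\mathcal B}$ be the two-sided ideal of morphisms that factor through an object of $\mathcal B$; $\mathcal B$ is additively closed if it is closed under isomorphisms and direct summands. The radical of $\mathcal C$ is $\mathrm{rad}_{\mathcal C}(X,Y)=\{h: 1_X-gh \text{ is invertible for all } g\in\mathcal C(Y,X)\}$. A two-sided ideal $I$ of $\mathcal C$ is heredity if $I^2=I$, $I\,\mathrm{rad}_{\mathcal C}\,I=0$, and $I(X,-)$ is a finitely generated projective $\mathcal C$-module for every $X$. Let $\{\mathcal B_j\}_{j\ge 0}$ be an ascending family of full additive subcategories of $\mathcal C$ with $\bigcup_j\mathcal B_j=\mathcal C$ (an exhaustive filtration; a finite one $\mathcal B_0\subseteq\dots\subseteq\mathcal B_n=\mathcal C$ is continued by $\mathcal B_j=\mathcal C$ for $j\ge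 n$). A Hom-finite Krull–Schmidt $K$-category $\mathcal C$ is quasi-hereditary with respect to $\{\mathcal B_j\}$ if $0=I_{\mathcal B_0}\subseteq I_{\mathcal B_1}\subseteq\cdots$ is an exhaustive chain of ideals such that $I_{\mathcal B_j}/I_{\mathcal B_{j-1}}$ is a heredity ideal of the quotient category $\mathcal C/I_{\mathcal B_{j-1}}$ for all $j\ge 1$. In that case, if the $\mathcal B_j$ are additively closed, the standard modules of level $j\geq 1$ are the modules $\mathcal C(E,-)/I_{\mathcal B_{j-1}}(E,-)$ with $E$ an indecomposable object of $\mathcal B_j$ that is not in $\mathcal B_{j-1}$. For a $\mathcal C$-module $F$ let $F^{[j]}$ be the trace of $\{\mathcal C(E,-)\}_{E\in\mathcal B_j}$ in $F$, that is, the sum of the images of all morphisms $\mathcal C(E,-)\to F$ with $E\in\mathcal B_j$; $F$ lies in $\mathcal F({}_{\mathcal C}\Delta)$ if, for every $j\ge 1$, $F^{[j]}/F^{[j-1]}$ is isomorphic to a finite direct sum of standard modules of level $j$. Let $\mathcal U$ and $\mathcal T$ be Hom-finite Krull–Schmidt $K$-categories that are quasi-hereditary with respect to filtrations $\{\mathcal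 U_j\}_{0\le j\le n}$ (finite, so $\mathcal U_n=\mathcal U$) and $\{\mathcal T_j\}_{j\ge 0}$ by additively closed full subcategories. Let $M:\mathcal U\otimes_K\mathcal T^{op}\to\mathrm{Mod}\,K$ be a $K$-linear functor, and suppose that the $\mathcal U$-module $M_T=M(-,T)$ lies in $\mathcal F({}_{\mathcal U}\Delta)$ for every $T\in\mathcal T$. Let $\Lambda=\left(\begin{smallmatrix}\mathcal T&0\\M&\mathcal U\end{smallmatrix}\right)$ be the triangular matrix category: its objects are the pairs $\left(\begin{smallmatrix}T&0\\M&U\end{smallmatrix}\right)$ with $T\in\mathcal T$ and $U\in\mathcal U$, its morphisms from $\left(\begin{smallmatrix}T&0\\M&U\end{smallmatrix}\right)$ to $\left(\begin{smallmatrix}T'&0\\M&U'\end{smallmatrix}\right)$ are the matrices $\left(\begin{smallmatrix}f&0\\m&g\end{smallmatrix}\right)$ with $f\in\mathcal T(T,T')$, $m\in M(U',T)$ and $g\in\mathcal U(U,U')$, and $$\left(\begin{smallmatrix}f_2&0\\m_2&g_2\end{smallmatrix}\right)\left(\begin{smallmatrix}f_1&0\\m_1&g_1\end{smallmatrix}\right)=\left(\begin{smallmatrix}f_2f_1&0\\M(1\otimes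 f_1^{op})(m_2)+M(g_2\otimes 1)(m_1)&g_2g_1\end{smallmatrix}\right).$$ Define full subcategories of $\Lambda$ by $$\Lambda_0=\left(\begin{smallmatrix}0&0\\M&0\end{smallmatrix}\right),\qquad \Lambda_j=\left\{\left(\begin{smallmatrix}0&0\\M&U\end{smallmatrix}\right):U\in\mathcal U_j\right\}\ (1\le j\le n),\qquad \Lambda_{n+j}=\left\{\left(\begin{smallmatrix}T&0\\M&U\end{smallmatrix}\right):T\in\mathcal T_j,\ U\in\mathcal U\right\}\ (j\ge 1),$$ where $0$ stands for any zero object. Then $\Lambda$ is a Hom-finite Krull–Schmidt $K$-category, $\{\Lambda_j\}_{j\ge 0}$ is an exhaustive filtration of $\Lambda$ by additively closed full additive subcategories, and $\Lambda$ is quasi-hereditary with respect to $\{\Lambda_j\}_{j\ge 0}$. -/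

import Mathlib

open CategoryTheory CategoryTheory.Limits Opposite
open scoped TensorProduct

universe w v u u₁ u₂

noncomputable section

namespace QHCat

/-! ### Hom-finite Krull–Schmidt categories -/

section Basic

instance hasBinaryBiproducts (C : Type u) [Category.{v} C] [Preadditive C]
    [HasFiniteBiproducts C] : HasBinaryBiproducts C :=
  hasBinaryBiproducts_of_finite_biproducts C

variable (C : Type u) [Category.{v} C]

/-- Every space of morphisms is a finite-dimensional `K`-vector space. -/
def IsHomFinite (K : Type w) [Field K] [Preadditive C] [Linear K C] : Prop :=
  ∀ X Y : C, FiniteDimensional K (X ⟶ Y)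

/-- Every object is a finite direct sum of indecomposable objects whose endomorphism rings are
local. -/
def IsKrullSchmidt [Preadditive C] [HasFiniteBiproducts C] : Prop :=
  ∀ X : C, ∃ (n : ℕ) (E : Fin n → C),
    (∀ i, Indecomposable (E i) ∧ IsLocalRing (End (E i))) ∧ Nonempty (X ≅ ⨁ E)

variable {C}

/-- The (full) subcategory of `C` on the objects satisfying `B` is an additive subcategory: it
contains a zero object and direct sums of any two of its objects. -/
structure IsAdditiveSubcat [Preadditive C] [HasFiniteBiproducts C] (B : ObjectProperty C) :
    Prop where
  exists_zero : ∃ Z, B Z ∧ IsZero Z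
  exists_biprod : ∀ X Y, B X → B Y → ∃ Z, B Z ∧ Nonempty (Z ≅ X ⊞ Y)

/-- A full additive subcategory is additively closed if it is closed under isomorphisms and
direct summands. -/
structure IsAdditivelyClosed [Preadditive C] [HasFiniteBiproducts C] (B : ObjectProperty C) :
    Prop extends IsAdditiveSubcat B where
  of_iso : ∀ X Y, (X ≅ Y) → B X → B Y
  of_summand : ∀ X Y, B (X ⊞ Y) → B X

/-- The radical of `C`: `h : X ⟶ Y` is radical if `1_X - g ∘ h` is invertible for all
`g : Y ⟶ X`. -/
def IsRadical [Preadditive C] {X Y : C} (h : X ⟶ Y) : Prop :=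
  ∀ g : Y ⟶ X, IsIso (𝟙 X - h ≫ g)

end Basic

/-! ### Modules over a category: subfunctors and quotients

A `C`-module is an additive functor from `C` to abelian groups. -/

section Modules

variable {C : Type u} [Category.{v} C]

instance hasFiniteBiproductsFunctor : HasFiniteBiproducts (C ⥤ AddCommGrpCat.{v}) :=
  HasFiniteBiproducts.of_hasFiniteProducts

/-- A subfunctor of a functor `F` from `C` to abelian groups. -/
structure Sub (F : C ⥤ AddCommGrpCat.{v}) where
  carrier : ∀ X : C, AddSubgroup (F.obj X)
  map_mem : ∀ {X Y : C} (f : X ⟶ Y) (x : F.obj X), x ∈ carrier X → F.map f x ∈ carrier Y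

namespace Sub

variable {F : C ⥤ AddCommGrpCat.{v}}

/-- The subfunctor, as a functor. -/
def toFunctor (G : Sub F) : C ⥤ AddCommGrpCat.{v} where
  obj X := AddCommGrpCat.of (G.carrier X)
  map {X Y} f := AddCommGrpCat.ofHom
    (((F.map f).hom.comp (G.carrier X).subtype).codRestrict (G.carrier Y)
      fun x => G.map_mem f x.1 x.2)
  map_id _ := AddCommGrpCat.hom_ext <| AddMonoidHom.ext fun x => Subtype.ext <|
    ConcreteCategory.congr_hom (F.map_id _) x.1
  map_comp f g := AddCommGrpCat.hom_ext <| AddMonoidHom.ext fun x => Subtype.ext <|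
    ConcreteCategory.congr_hom (F.map_comp f g) x.1

/-- The quotient functor `F / G`. -/
def quotient (G : Sub F) : C ⥤ AddCommGrpCat.{v} where
  obj X := AddCommGrpCat.of (F.obj X ⧸ G.carrier X)
  map {X Y} f := AddCommGrpCat.ofHom
    (QuotientAddGroup.map (G.carrier X) (G.carrier Y) (F.map f).hom
      fun x hx => G.map_mem f x hx)
  map_id X := AddCommGrpCat.hom_ext <| QuotientAddGroup.addMonoidHom_ext _ <|
    AddMonoidHom.ext fun x => congrArg (QuotientAddGroup.mk' (G.carrier X))
      (ConcreteCategory.congr_hom (F.map_id X) x)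
  map_comp {_ _ Z} f g := AddCommGrpCat.hom_ext <| QuotientAddGroup.addMonoidHom_ext _ <|
    AddMonoidHom.ext fun x => congrArg (QuotientAddGroup.mk' (G.carrier Z))
      (ConcreteCategory.congr_hom (F.map_comp f g) x)

/-- `G ∩ H`, as a subfunctor of `H`. -/
def restrict (G H : Sub F) : Sub H.toFunctor where
  carrier X := (G.carrier X).addSubgroupOf (H.carrier X)
  map_mem f x hx := G.map_mem f x.1 hx

instance toFunctor_additive [Preadditive C] [F.Additive] (G : Sub F) : G.toFunctor.Additive where
  map_add {_ _ f g} := AddCommGrpCat.hom_ext <| AddMonoidHom.ext fun x => Subtype.ext <|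
    ConcreteCategory.congr_hom (F.map_add (f := f) (g := g)) x.1

end Sub

/-- The trace of the modules `C(E,-)`, `E` in `B`, in `F`: the sum of the images of all morphisms
`C(E,-) ⟶ F` with `E` in `B`. -/
def trace [Preadditive C] (B : ObjectProperty C) (F : C ⥤ AddCommGrpCat.{v}) : Sub F where
  carrier X := ⨆ (E : C) (_ : B E) (η : preadditiveCoyoneda.obj (op E) ⟶ F), (η.app X).hom.range
  map_mem {X Y} f x hx := by
    suffices h : (⨆ (E : C) (_ : B E) (η : preadditiveCoyoneda.obj (op E) ⟶ F),
        (η.app X).hom.range) ≤ (⨆ (E : C) (_ : B E) (η : preadditiveCoyoneda.obj (op E) ⟶ F),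
        (η.app Y).hom.range).comap (F.map f).hom from h hx
    refine iSup_le fun E => iSup_le fun hE => iSup_le fun η => ?_
    rintro _ ⟨s, rfl⟩
    refine AddSubgroup.mem_iSup_of_mem E (AddSubgroup.mem_iSup_of_mem hE
      (AddSubgroup.mem_iSup_of_mem η ⟨(preadditiveCoyoneda.obj (op E)).map f s, ?_⟩))
    exact ConcreteCategory.congr_hom (η.naturality f) s

/-- `F` is finitely generated: a finite family of elements of `F` generates `F`, i.e. induces an
epimorphism onto `F` from a finite direct sum of representable modules `C(E i,-)`. -/
def IsFinGen (F : C ⥤ AddCommGrpCat.{v}) : Prop :=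
  ∃ (n : ℕ) (E : Fin n → C) (x : ∀ i, F.obj (E i)),
    ∀ (Y : C) (y : F.obj Y), ∃ s : ∀ i, E i ⟶ Y, y = ∑ i, F.map (s i) (x i)

end Modules

/-! ### Two-sided ideals, quotient categories, heredity chains -/

section Ideals

/-- A two-sided ideal of a preadditive category. In a `K`-linear category these are automatically
closed under scalars, see `TwoSidedIdeal.smul_mem`. -/
@[ext]
structure TwoSidedIdeal (C : Type u) [Category.{v} C] [Preadditive C] where
  hom : ∀ X Y : C, AddSubgroup (X ⟶ Y)
  comp_mem : ∀ {X Y Z : C} (f : X ⟶ Y) (g : Y ⟶ Z), f ∈ hom X Y → f ≫ g ∈ hom X Z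
  mem_comp : ∀ {X Y Z : C} (f : X ⟶ Y) (g : Y ⟶ Z), g ∈ hom Y Z → f ≫ g ∈ hom X Z

namespace TwoSidedIdeal

variable {C : Type u} [Category.{v} C] [Preadditive C]

theorem smul_mem {K : Type w} [Field K] [Linear K C] (I : TwoSidedIdeal C) {X Y : C} (a : K)
    {f : X ⟶ Y} (hf : f ∈ I.hom X Y) : a • f ∈ I.hom X Y := by
  have h := I.comp_mem f (a • 𝟙 Y) hf
  rwa [Linear.comp_smul, Category.comp_id] at h

/-- The congruence `f - g ∈ I`. -/
def rel (I : TwoSidedIdeal C) : HomRel C := fun X Y f g => f - g ∈ I.hom X Y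

instance rel_congruence (I : TwoSidedIdeal C) : Congruence I.rel where
  equivalence :=
    { refl := fun f => by simp [rel]
      symm := fun {f g} h => by
        have := neg_mem h
        rwa [neg_sub] at this
      trans := fun {f g h} h₁ h₂ => by
        have := add_mem h₁ h₂
        rwa [sub_add_sub_cancel] at this }
  comp_left f g g' h := by
    have := I.mem_comp f _ h
    rwa [Preadditive.comp_sub] at this
  comp_right g h := by
    have := I.comp_mem _ g h
    rwa [Preadditive.sub_comp] at this

/-- The quotient category `C / I`: the same objects, and `C(X,Y) / I(X,Y)` as morphisms. -/
abbrev Quot (I : TwoSidedIdeal C) : Type u := CategoryTheory.Quotient I.rel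

theorem rel_add (I : TwoSidedIdeal C) ⦃X Y : C⦄ (f₁ f₂ g₁ g₂ : X ⟶ Y) (hf : I.rel f₁ f₂)
    (hg : I.rel g₁ g₂) : I.rel (f₁ + g₁) (f₂ + g₂) := by
  have := add_mem hf hg
  rwa [← add_sub_add_comm] at this

instance quotPreadditive (I : TwoSidedIdeal C) : Preadditive I.Quot :=
  CategoryTheory.Quotient.preadditive I.rel I.rel_add

/-- The projection `C ⥤ C / I`. -/
abbrev proj (I : TwoSidedIdeal C) : C ⥤ I.Quot := CategoryTheory.Quotient.functor I.rel

instance proj_additive (I : TwoSidedIdeal C) : I.proj.Additive :=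
  CategoryTheory.Quotient.functor_additive I.rel I.rel_add

/-- The ideal `(J + I) / I` of `C / I`, i.e. `J / I` when `I ⊆ J`. -/
def modIdeal (J I : TwoSidedIdeal C) : TwoSidedIdeal I.Quot where
  hom X Y := (J.hom X.as Y.as).map (I.proj.mapAddHom (X := X.as) (Y := Y.as))
  comp_mem {X Y Z} f g := by
    rintro ⟨f, hf, rfl⟩
    obtain ⟨g, rfl⟩ := I.proj.map_surjective (X := Y.as) (Y := Z.as) g
    exact ⟨f ≫ g, J.comp_mem f g hf, I.proj.map_comp f g⟩
  mem_comp {X Y Z} f g := by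
    rintro ⟨g, hg, rfl⟩
    obtain ⟨f, rfl⟩ := I.proj.map_surjective (X := X.as) (Y := Y.as) f
    exact ⟨f ≫ g, J.mem_comp f g hg, I.proj.map_comp f g⟩

/-- The `C`-module `I(X,-)`, a submodule of `C(X,-)`. -/
def row (I : TwoSidedIdeal C) (X : C) : Sub (preadditiveCoyoneda.obj (op X)) where
  carrier Y := I.hom X Y
  map_mem f x hx := I.comp_mem x f hx

/-- `I` is a heredity ideal: `I ^ 2 = I`, `I · rad · I = 0`, and all `I(X,-)` are
finitely generated projective modules. -/
structure IsHeredity (I : TwoSidedIdeal C) : Prop where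
  idempotent : ∀ X Y : C, I.hom X Y = AddSubgroup.closure
    {h | ∃ (Z : C) (f : X ⟶ Z) (g : Z ⟶ Y), f ∈ I.hom X Z ∧ g ∈ I.hom Z Y ∧ f ≫ g = h}
  rad : ∀ {W X Y Z : C} (f : W ⟶ X) (h : X ⟶ Y) (g : Y ⟶ Z),
    f ∈ I.hom W X → IsRadical h → g ∈ I.hom Y Z → f ≫ h ≫ g = 0
  projective : ∀ X : C, Projective (AdditiveFunctor.of (I.row X).toFunctor)
  finGen : ∀ X : C, IsFinGen (I.row X).toFunctor

/-- `0 = I 0 ⊆ I 1 ⊆ ⋯` is a heredity chain of ideals of `C`. -/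
structure IsHeredityChain (I : ℕ → TwoSidedIdeal C) : Prop where
  zero : ∀ X Y : C, (I 0).hom X Y = ⊥
  mono : ∀ (j : ℕ) (X Y : C), (I j).hom X Y ≤ (I (j + 1)).hom X Y
  exhaustive : ∀ (X Y : C) (f : X ⟶ Y), ∃ j, f ∈ (I j).hom X Y
  heredity : ∀ j : ℕ, ((I (j + 1)).modIdeal (I j)).IsHeredity

end TwoSidedIdeal

variable {C : Type u} [Category.{v} C] [Preadditive C] [HasFiniteBiproducts C]

/-- The ideal `I_B` of the morphisms that factor through an object of the additive
subcategory `B`. -/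
def factorIdeal (B : ObjectProperty C) (hB : IsAdditiveSubcat B) : TwoSidedIdeal C where
  hom X Y :=
    { carrier := {f | ∃ (Z : C) (_ : B Z) (r : X ⟶ Z) (s : Z ⟶ Y), r ≫ s = f}
      zero_mem' := by
        obtain ⟨Z, hZ, -⟩ := hB.exists_zero
        exact ⟨Z, hZ, 0, 0, by simp⟩
      add_mem' := by
        rintro _ _ ⟨Z, hZ, r, s, rfl⟩ ⟨Z', hZ', r', s', rfl⟩
        obtain ⟨W, hW, ⟨e⟩⟩ := hB.exists_biprod Z Z' hZ hZ'
        exact ⟨W, hW, biprod.lift r r' ≫ e.inv, e.hom ≫ biprod.desc s s', by simp⟩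
      neg_mem' := by
        rintro _ ⟨Z, hZ, r, s, rfl⟩
        exact ⟨Z, hZ, -r, s, by simp⟩ }
  comp_mem := by
    rintro X Y Z _ g ⟨W, hW, r, s, rfl⟩
    exact ⟨W, hW, r, s ≫ g, by simp⟩
  mem_comp := by
    rintro X Y Z f _ ⟨W, hW, r, s, rfl⟩
    exact ⟨W, hW, f ≫ r, s, by simp⟩

/-- An exhaustive filtration of `C` by full additive subcategories. A finite filtration
`B 0 ⊆ ⋯ ⊆ B n = C` is continued by `B j = C` for `j ≥ n`. -/
structure IsExhaustiveFiltration (B : ℕ → ObjectProperty C) : Prop where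
  additive : ∀ j, IsAdditiveSubcat (B j)
  mono : ∀ (j : ℕ) (X : C), B j X → B (j + 1) X
  exhaustive : ∀ X : C, ∃ j, B j X

variable (K : Type w) [Field K] [Linear K C]

/-- The Hom-finite Krull–Schmidt `K`-category `C` is quasi-hereditary with respect to the
exhaustive filtration `B` by full additive subcategories. -/
structure IsQuasiHereditary (B : ℕ → ObjectProperty C) : Prop where
  homFinite : IsHomFinite C K
  krullSchmidt : IsKrullSchmidt C
  filtration : IsExhaustiveFiltration B
  heredityChain : TwoSidedIdeal.IsHeredityChain
    fun j => factorIdeal (B j) (filtration.additive j)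

/-- The standard module `C(E,-) / I_{B j}(E,-)`; it is the standard module of level `j + 1`
attached to `E` when `E` is indecomposable in `B (j + 1)` and not in `B j`. -/
def standard (B : ℕ → ObjectProperty C) (hB : ∀ j, IsAdditiveSubcat (B j)) (j : ℕ) (E : C) :
    C ⥤ AddCommGrpCat.{v} :=
  ((factorIdeal (B j) (hB j)).row E).quotient

/-- `F` lies in `F(Δ)`: for all `j ≥ 1`, the factor `F^[j] / F^[j-1]` of the trace filtration
of `F` is a finite direct sum of standard modules of level `j`. -/
def IsDeltaFiltered (B : ℕ → ObjectProperty C) (hB : ∀ j, IsAdditiveSubcat (B j))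
    (F : C ⥤ AddCommGrpCat.{v}) : Prop :=
  ∀ j : ℕ, ∃ (m : ℕ) (E : Fin m → C),
    (∀ i, Indecomposable (E i) ∧ B (j + 1) (E i) ∧ ¬ B j (E i)) ∧
    Nonempty (((trace (B j) F).restrict (trace (B (j + 1)) F)).quotient ≅
      ⨁ fun i => standard B hB j (E i))

end Ideals

/-! ### Tensor products of `K`-categories -/

section Tensor

/-- The opposite of a `K`-category is a `K`-category. -/
instance linearOp (K : Type w) [Field K] (C : Type u) [Category.{v} C] [Preadditive C] [Linear K C] : Linear K Cᵒᵖ where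
  homModule X Y :=
    { smul := fun a f => (a • f.unop).op
      one_smul := fun f => congrArg Quiver.Hom.op (one_smul K f.unop)
      mul_smul := fun a b f => congrArg Quiver.Hom.op (mul_smul a b f.unop)
      smul_zero := fun a => congrArg Quiver.Hom.op (smul_zero (A := Y.unop ⟶ X.unop) a)
      smul_add := fun a f g => congrArg Quiver.Hom.op (smul_add a f.unop g.unop)
      add_smul := fun a b f => congrArg Quiver.Hom.op (add_smul a b f.unop)
      zero_smul := fun f => congrArg Quiver.Hom.op (zero_smul K f.unop) }
  smul_comp _ _ _ a f g := congrArg Quiver.Hom.op (Linear.comp_smul _ _ _ g.unop a f.unop)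
  comp_smul _ _ _ f a g := congrArg Quiver.Hom.op (Linear.smul_comp _ _ _ a g.unop f.unop)

/-- The objects of the tensor product `C ⊗_K D` of two `K`-categories: pairs of objects. -/
@[ext]
structure TensorCat (K : Type w) (C : Type u₁) (D : Type u₂) where
  fst : C
  snd : D

namespace TensorCat

variable {K : Type w} [Field K] {C : Type u₁} [Category.{v} C] [Preadditive C] [Linear K C]
  {D : Type u₂} [Category.{v} D] [Preadditive D] [Linear K D]

/-- Morphisms `(p₁,q₁) ⟶ (p₂,q₂)` form `C(p₁,p₂) ⊗ D(q₁,q₂)`, and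
`(g₁ ⊗ g₂) ∘ (f₁ ⊗ f₂) = (g₁ ∘ f₁) ⊗ (g₂ ∘ f₂)`. -/
instance category : Category.{v} (TensorCat K C D) where
  Hom X Y := (X.fst ⟶ Y.fst) ⊗[K] (X.snd ⟶ Y.snd)
  id X := 𝟙 X.fst ⊗ₜ[K] 𝟙 X.snd
  comp {X Y Z} f g := TensorProduct.map₂ (Linear.comp (S := K) X.fst Y.fst Z.fst)
    (Linear.comp (S := K) X.snd Y.snd Z.snd) f g
  id_comp {X Y} f := by
    induction f using TensorProduct.induction_on with
    | zero => simp
    | tmul a b => simp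
    | add a b ha hb => rw [map_add, ha, hb]
  comp_id {X Y} f := by
    induction f using TensorProduct.induction_on with
    | zero => simp
    | tmul a b => simp
    | add a b ha hb => rw [map_add, LinearMap.add_apply, ha, hb]
  assoc {W X Y Z} f g h := by
    induction f using TensorProduct.induction_on with
    | zero => simp
    | add a b ha hb => simp only [map_add, LinearMap.add_apply, ha, hb]
    | tmul f₁ f₂ =>
      induction g using TensorProduct.induction_on with
      | zero => simp
      | add a b ha hb => simp only [map_add, LinearMap.add_apply, ha, hb]
      | tmul g₁ g₂ =>
        induction h using TensorProduct.induction_on with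
        | zero => simp
        | add a b ha hb => simp only [map_add, ha, hb]
        | tmul h₁ h₂ => simp

/-- The morphism `f ⊗ g` of `C ⊗_K D`. -/
def tmul {X Y : TensorCat K C D} (f : X.fst ⟶ Y.fst) (g : X.snd ⟶ Y.snd) : X ⟶ Y :=
  f ⊗ₜ[K] g

theorem tmul_id (X : TensorCat K C D) : tmul (𝟙 X.fst) (𝟙 X.snd) = 𝟙 X := rfl

theorem tmul_comp {X Y Z : TensorCat K C D} (f : X.fst ⟶ Y.fst) (g : X.snd ⟶ Y.snd)
    (f' : Y.fst ⟶ Z.fst) (g' : Y.snd ⟶ Z.snd) :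
    (tmul f g : X ⟶ Y) ≫ tmul f' g' = tmul (f ≫ f') (g ≫ g') := rfl

instance preadditive : Preadditive (TensorCat K C D) where
  homGroup X Y := inferInstanceAs (AddCommGroup ((X.fst ⟶ Y.fst) ⊗[K] (X.snd ⟶ Y.snd)))
  add_comp X Y Z f f' g := LinearMap.map_add₂ (TensorProduct.map₂
    (Linear.comp (S := K) X.fst Y.fst Z.fst) (Linear.comp (S := K) X.snd Y.snd Z.snd)) f f' g
  comp_add X Y Z f g g' := LinearMap.map_add (TensorProduct.map₂
    (Linear.comp (S := K) X.fst Y.fst Z.fst) (Linear.comp (S := K) X.snd Y.snd Z.snd) f) g g'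

instance linear : Linear K (TensorCat K C D) where
  homModule X Y := inferInstanceAs (Module K ((X.fst ⟶ Y.fst) ⊗[K] (X.snd ⟶ Y.snd)))
  smul_comp X Y Z a f g := LinearMap.map_smul₂ (TensorProduct.map₂
    (Linear.comp (S := K) X.fst Y.fst Z.fst) (Linear.comp (S := K) X.snd Y.snd Z.snd)) a f g
  comp_smul X Y Z f a g := LinearMap.map_smul (TensorProduct.map₂
    (Linear.comp (S := K) X.fst Y.fst Z.fst) (Linear.comp (S := K) X.snd Y.snd Z.snd) f) a g

theorem tmul_add_left {X Y : TensorCat K C D} (f f' : X.fst ⟶ Y.fst) (g : X.snd ⟶ Y.snd) :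
    (tmul (f + f') g : X ⟶ Y) = tmul f g + tmul f' g := TensorProduct.add_tmul f f' g

theorem tmul_add_right {X Y : TensorCat K C D} (f : X.fst ⟶ Y.fst) (g g' : X.snd ⟶ Y.snd) :
    (tmul f (g + g') : X ⟶ Y) = tmul f g + tmul f g' := TensorProduct.tmul_add f g g'

theorem tmul_smul_left {X Y : TensorCat K C D} (a : K) (f : X.fst ⟶ Y.fst)
    (g : X.snd ⟶ Y.snd) : (tmul (a • f) g : X ⟶ Y) = a • tmul f g :=
  TensorProduct.smul_tmul' a f g

theorem tmul_smul_right {X Y : TensorCat K C D} (a : K) (f : X.fst ⟶ Y.fst)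
    (g : X.snd ⟶ Y.snd) : (tmul f (a • g) : X ⟶ Y) = a • tmul f g :=
  TensorProduct.tmul_smul a f g

/-- The functor `C ⥤ C ⊗_K D`, `f ↦ f ⊗ 1_Y`. -/
def inl (K : Type w) [Field K] (C : Type u₁) [Category.{v} C] [Preadditive C] [Linear K C]
    {D : Type u₂} [Category.{v} D] [Preadditive D] [Linear K D] (Y : D) :
    C ⥤ TensorCat K C D where
  obj X := ⟨X, Y⟩
  map f := tmul f (𝟙 Y)
  map_id _ := rfl
  map_comp f g := by rw [tmul_comp, Category.id_comp]

end TensorCat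

end Tensor

/-! ### Triangular matrix categories -/

section Triangular

variable {K : Type w} [Field K]
  {𝒯 : Type u₁} [Category.{v} 𝒯] [Preadditive 𝒯] [Linear K 𝒯]
  {𝒰 : Type u₂} [Category.{v} 𝒰] [Preadditive 𝒰] [Linear K 𝒰]

/-- The objects `[[t, 0], [M, u]]` of the triangular matrix category `[[𝒯, 0], [M, 𝒰]]`. -/
@[ext]
structure TriCat (M : TensorCat K 𝒰 𝒯ᵒᵖ ⥤ ModuleCat.{v} K) where
  t : 𝒯
  u : 𝒰

namespace TriCat

variable (M : TensorCat K 𝒰 𝒯ᵒᵖ ⥤ ModuleCat.{v} K)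

/-- The `𝒰`-module `M_T = M(-,T)`. -/
def column (T : 𝒯) : 𝒰 ⥤ AddCommGrpCat.{v} :=
  TensorCat.inl K 𝒰 (op T) ⋙ M ⋙ forget₂ (ModuleCat.{v} K) AddCommGrpCat.{v}

variable {M}

/-- `m • f = M(1 ⊗ f^op)(m)` for `m ∈ M(U, T')` and `f : T ⟶ T'`. -/
def actT {T T' : 𝒯} {U : 𝒰} (f : T ⟶ T') :
    M.obj ⟨U, op T'⟩ →ₗ[K] M.obj ⟨U, op T⟩ :=
  (M.map (TensorCat.tmul (X := ⟨U, op T'⟩) (Y := ⟨U, op T⟩) (𝟙 U) f.op)).hom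

/-- `g • m = M(g ⊗ 1)(m)` for `m ∈ M(U, T)` and `g : U ⟶ U'`. -/
def actU {T : 𝒯} {U U' : 𝒰} (g : U ⟶ U') :
    M.obj ⟨U, op T⟩ →ₗ[K] M.obj ⟨U', op T⟩ :=
  (M.map (TensorCat.tmul (X := ⟨U, op T⟩) (Y := ⟨U', op T⟩) g (𝟙 (op T)))).hom

theorem actT_id {T : 𝒯} {U : 𝒰} (m : M.obj ⟨U, op T⟩) : actT (𝟙 T) m = m :=
  ConcreteCategory.congr_hom (M.map_id ⟨U, op T⟩) m

theorem actU_id {T : 𝒯} {U : 𝒰} (m : M.obj ⟨U, op T⟩) : actU (𝟙 U) m = m :=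
  ConcreteCategory.congr_hom (M.map_id ⟨U, op T⟩) m

theorem actT_comp {T T' T'' : 𝒯} {U : 𝒰} (f : T ⟶ T') (f' : T' ⟶ T'')
    (m : M.obj ⟨U, op T''⟩) : actT (f ≫ f') m = actT f (actT f' m) := by
  rw [actT, op_comp, ← Category.comp_id (𝟙 U)]
  exact ConcreteCategory.congr_hom (M.map_comp
    (TensorCat.tmul (X := ⟨U, op T''⟩) (Y := ⟨U, op T'⟩) (𝟙 U) f'.op)
    (TensorCat.tmul (X := ⟨U, op T'⟩) (Y := ⟨U, op T⟩) (𝟙 U) f.op)) m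

theorem actU_comp {T : 𝒯} {U U' U'' : 𝒰} (g : U ⟶ U') (g' : U' ⟶ U'')
    (m : M.obj ⟨U, op T⟩) : actU (g ≫ g') m = actU g' (actU g m) := by
  rw [actU, ← Category.comp_id (𝟙 (op T))]
  exact ConcreteCategory.congr_hom (M.map_comp
    (TensorCat.tmul (X := ⟨U, op T⟩) (Y := ⟨U', op T⟩) g (𝟙 (op T)))
    (TensorCat.tmul (X := ⟨U', op T⟩) (Y := ⟨U'', op T⟩) g' (𝟙 (op T)))) m

theorem actT_actU {T T' : 𝒯} {U U' : 𝒰} (f : T ⟶ T') (g : U ⟶ U') (m : M.obj ⟨U, op T'⟩) :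
    actT f (actU g m) = actU g (actT f m) := by
  have h₁ := ConcreteCategory.congr_hom (M.map_comp
    (TensorCat.tmul (X := ⟨U, op T'⟩) (Y := ⟨U', op T'⟩) g (𝟙 (op T')))
    (TensorCat.tmul (X := ⟨U', op T'⟩) (Y := ⟨U', op T⟩) (𝟙 U') f.op)) m
  have h₂ := ConcreteCategory.congr_hom (M.map_comp
    (TensorCat.tmul (X := ⟨U, op T'⟩) (Y := ⟨U, op T⟩) (𝟙 U) f.op)
    (TensorCat.tmul (X := ⟨U, op T⟩) (Y := ⟨U', op T⟩) g (𝟙 (op T)))) m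
  rw [TensorCat.tmul_comp, Category.comp_id, Category.id_comp] at h₁ h₂
  exact h₁.symm.trans h₂

/-- A morphism from `[[t, 0], [M, u]]` to `[[t', 0], [M, u']]` is a triple `(f, m, g)`, i.e. a
matrix `[[f, 0], [m, g]]`, with `f : t ⟶ t'`, `m ∈ M(u', t)` and `g : u ⟶ u'`; morphisms are
composed as matrices:
`[[f₂, 0], [m₂, g₂]] ∘ [[f₁, 0], [m₁, g₁]] = [[f₂ ∘ f₁, 0], [m₂ • f₁ + g₂ • m₁, g₂ ∘ g₁]]`. -/
instance category : Category.{v} (TriCat M) where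
  Hom X Y := (X.t ⟶ Y.t) × M.obj ⟨Y.u, op X.t⟩ × (X.u ⟶ Y.u)
  id X := (𝟙 X.t, 0, 𝟙 X.u)
  comp p q := (p.1 ≫ q.1, actT p.1 q.2.1 + actU q.2.2 p.2.1, p.2.2 ≫ q.2.2)
  id_comp p := by simp [actT_id]
  comp_id p := by simp [actU_id]
  assoc p q r := by
    simp [actT_comp, actU_comp, actT_actU, add_assoc]

/-- The matrix `[[f, 0], [m, g]]`. -/
def mkHom {X Y : TriCat M} (f : X.t ⟶ Y.t) (m : M.obj ⟨Y.u, op X.t⟩) (g : X.u ⟶ Y.u) : X ⟶ Y :=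
  (f, m, g)

theorem mkHom_comp {X Y Z : TriCat M} (f₁ : X.t ⟶ Y.t) (m₁ : M.obj ⟨Y.u, op X.t⟩)
    (g₁ : X.u ⟶ Y.u) (f₂ : Y.t ⟶ Z.t) (m₂ : M.obj ⟨Z.u, op Y.t⟩) (g₂ : Y.u ⟶ Z.u) :
    (mkHom f₁ m₁ g₁ : X ⟶ Y) ≫ mkHom f₂ m₂ g₂ =
      mkHom (f₁ ≫ f₂) (actT f₁ m₂ + actU g₂ m₁) (g₁ ≫ g₂) := rfl

theorem id_eq (X : TriCat M) : 𝟙 X = mkHom (𝟙 X.t) 0 (𝟙 X.u) := rfl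

theorem actT_add [M.Additive] {T T' : 𝒯} {U : 𝒰} (f f' : T ⟶ T') (m : M.obj ⟨U, op T'⟩) :
    actT (f + f') m = actT f m + actT f' m := by
  rw [actT, op_add, TensorCat.tmul_add_right, M.map_add]
  rfl

theorem actU_add [M.Additive] {T : 𝒯} {U U' : 𝒰} (g g' : U ⟶ U') (m : M.obj ⟨U, op T⟩) :
    actU (g + g') m = actU g m + actU g' m := by
  rw [actU, TensorCat.tmul_add_left, M.map_add]
  rfl

theorem actT_smul [M.Linear K] {T T' : 𝒯} {U : 𝒰} (a : K) (f : T ⟶ T')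
    (m : M.obj ⟨U, op T'⟩) : actT (a • f) m = a • actT f m := by
  have h : (a • f).op = a • f.op := rfl
  rw [actT, h, TensorCat.tmul_smul_right, M.map_smul]
  rfl

theorem actU_smul [M.Linear K] {T : 𝒯} {U U' : 𝒰} (a : K) (g : U ⟶ U')
    (m : M.obj ⟨U, op T⟩) : actU (a • g) m = a • actU g m := by
  rw [actU, TensorCat.tmul_smul_left, M.map_smul]
  rfl

instance preadditive [M.Additive] : Preadditive (TriCat M) where
  homGroup X Y := inferInstanceAs
    (AddCommGroup ((X.t ⟶ Y.t) × M.obj ⟨Y.u, op X.t⟩ × (X.u ⟶ Y.u)))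
  add_comp X Y Z p p' q := by
    refine Prod.ext (Preadditive.add_comp _ _ _ _ _ _) (Prod.ext ?_
      (Preadditive.add_comp _ _ _ _ _ _))
    change actT (p.1 + p'.1) q.2.1 + actU q.2.2 (p.2.1 + p'.2.1) =
      (actT p.1 q.2.1 + actU q.2.2 p.2.1) + (actT p'.1 q.2.1 + actU q.2.2 p'.2.1)
    rw [actT_add, map_add]
    abel
  comp_add X Y Z p q q' := by
    refine Prod.ext (Preadditive.comp_add _ _ _ _ _ _) (Prod.ext ?_
      (Preadditive.comp_add _ _ _ _ _ _))
    change actT p.1 (q.2.1 + q'.2.1) + actU (q.2.2 + q'.2.2) p.2.1 =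
      (actT p.1 q.2.1 + actU q.2.2 p.2.1) + (actT p.1 q'.2.1 + actU q'.2.2 p.2.1)
    rw [actU_add, map_add]
    abel

instance linear [M.Additive] [M.Linear K] : Linear K (TriCat M) where
  homModule X Y := inferInstanceAs
    (Module K ((X.t ⟶ Y.t) × M.obj ⟨Y.u, op X.t⟩ × (X.u ⟶ Y.u)))
  smul_comp X Y Z a p q := by
    refine Prod.ext (Linear.smul_comp _ _ _ _ _ _) (Prod.ext ?_ (Linear.smul_comp _ _ _ _ _ _))
    change actT (a • p.1) q.2.1 + actU q.2.2 (a • p.2.1) =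
      a • (actT p.1 q.2.1 + actU q.2.2 p.2.1)
    rw [actT_smul, map_smul, smul_add]
  comp_smul X Y Z p a q := by
    refine Prod.ext (Linear.comp_smul _ _ _ _ _ _) (Prod.ext ?_ (Linear.comp_smul _ _ _ _ _ _))
    change actT p.1 (a • q.2.1) + actU (a • q.2.2) p.2.1 =
      a • (actT p.1 q.2.1 + actU q.2.2 p.2.1)
    rw [actU_smul, map_smul, smul_add]

theorem mkHom_zero [M.Additive] {X Y : TriCat M} : (mkHom 0 0 0 : X ⟶ Y) = 0 := rfl

theorem mkHom_add [M.Additive] {X Y : TriCat M} (f f' : X.t ⟶ Y.t)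
    (m m' : M.obj ⟨Y.u, op X.t⟩) (g g' : X.u ⟶ Y.u) :
    (mkHom f m g : X ⟶ Y) + mkHom f' m' g' = mkHom (f + f') (m + m') (g + g') := rfl

theorem mkHom_sum [M.Additive] {X Y : TriCat M} {ι : Type} (s : Finset ι) (f : ι → (X.t ⟶ Y.t))
    (g : ι → (X.u ⟶ Y.u)) :
    ∑ i ∈ s, (mkHom (f i) 0 (g i) : X ⟶ Y) = mkHom (∑ i ∈ s, f i) 0 (∑ i ∈ s, g i) := by
  classical
  induction s using Finset.induction_on with
  | empty => rfl
  | insert i s hi ih => rw [Finset.sum_insert hi, Finset.sum_insert hi, Finset.sum_insert hi, ih,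
      mkHom_add, add_zero]

/-- The triangular matrix category is additive: direct sums are formed componentwise. -/
instance hasFiniteBiproducts [HasFiniteBiproducts 𝒯] [HasFiniteBiproducts 𝒰] [M.Additive] :
    HasFiniteBiproducts (TriCat M) where
  out n :=
    { has_biproduct := fun F => by
        let b : Bicone F :=
          { pt := ⟨⨁ fun i => (F i).t, ⨁ fun i => (F i).u⟩
            π := fun i => mkHom (biproduct.π (fun i => (F i).t) i) 0
              (biproduct.π (fun i => (F i).u) i)
            ι := fun i => mkHom (biproduct.ι (fun i => (F i).t) i) 0
              (biproduct.ι (fun i => (F i).u) i)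
            ι_π := fun i j => by
              rw [mkHom_comp, map_zero, map_zero, add_zero]
              by_cases h : i = j
              · subst h
                simp [id_eq]
              · rw [dif_neg h, biproduct.ι_π_ne _ h, biproduct.ι_π_ne _ h, mkHom_zero] }
        refine hasBiproduct_of_total b ?_
        simp only [b, mkHom_comp, map_zero, add_zero]
        rw [mkHom_sum, biproduct.total, biproduct.total]
        rfl }

variable (M)

/-- The filtration `Λ_0 = [[0, 0], [M, 0]]`, `Λ_j = [[0, 0], [M, 𝒰_j]]` for `1 ≤ j ≤ n`,
`Λ_{n+j} = [[𝒯_j, 0], [M, 𝒰]]` for `j ≥ 1`. -/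
def filtration (n : ℕ) (BT : ℕ → ObjectProperty 𝒯) (BU : ℕ → ObjectProperty 𝒰) (j : ℕ) :
    ObjectProperty (TriCat M) := fun X =>
  if j = 0 then IsZero X.t ∧ IsZero X.u
  else if j ≤ n then IsZero X.t ∧ BU j X.u
  else BT (j - n) X.t

end TriCat

end Triangular

end QHCat

end

namespace QHCat

/-! ### Projective modules that are generated by one element -/

section Modules

variable {C : Type u} [Category.{v} C]

/-! All three conditions on a heredity ideal can be tested entry by entry on matrices. With
truncated subtraction, `Λ_j` consists of the objects whose diagonal entries lie in `𝒯_{j-n}` and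
`𝒰_j`, and at each level one corner is degenerate: either `𝒯_{j-n}` contains only zero objects (`j ≤
n`) or `𝒰_j` is all of `𝒰` (`j ≥ n`). This dichotomy makes `I_{Λ_j}` the ideal of matrices whose
diagonal entries lie in `I_{𝒯_{j-n}}` and `I_{𝒰_j}` and whose lower left entry lies in the trace of
`𝒰_j` in the column `M_T` (`mem_factorIdeal_diag_iff`).

Idempotence is automatic for ideals of morphisms factoring through a subcategory. The radical
condition says that a morphism between objects of the larger subcategory which is radical modulo the
smaller ideal lies in that ideal (`isHeredity_factorIdeal`, `mem_of_isRadicalMod`). It therefore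
passes to the two corners, while the lower left entry is harmless by the dichotomy.

For projectivity, finite generation over an additive category means generation by one element `x : X
⟶ E`. Projectivity then means that some `e : E ⟶ E` fixes `x` and kills whatever `x` kills; such an
`e` is idempotent, and the module is the summand of `C(E,-)` it cuts out. Lifting this to
congruences in `C` gives `IsProjectiveMod`. The `Δ`-filtration enters here: each factor of the trace
filtration of `M_T` is generated by one element with annihilator exactly `I_{𝒰_j}`
(`IsDeltaFiltered.exists_generator`), so the lower left entry contributes a summand with `e = 1`.
The generators for the three entries combine into one for `Λ` (`isProjectiveMod_diag`).

Hom-finiteness uses the `Δ`-filtration again: the finitely many trace factors bound the dimension of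
each `M(U,T)`. The Krull–Schmidt property comes from decomposing the two diagonal entries
separately. -/

/-- The image of a morphism of modules. -/
def Sub.range {F G : C ⥤ AddCommGrpCat.{v}} (φ : F ⟶ G) : Sub G where
  carrier X := (φ.app X).hom.range
  map_mem {X Y} f x := by
    rintro ⟨y, rfl⟩
    exact ⟨F.map f y, ConcreteCategory.congr_hom (φ.naturality f) y⟩

/-- The projection onto the quotient by a submodule. -/
def Sub.toQuotient {F : C ⥤ AddCommGrpCat.{v}} (G : Sub F) : F ⟶ G.quotient where
  app X := AddCommGrpCat.ofHom (QuotientAddGroup.mk' (G.carrier X))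

theorem Sub.toQuotient_eq_zero_iff {F : C ⥤ AddCommGrpCat.{v}} (G : Sub F) {X : C}
    (x : F.obj X) : G.toQuotient.app X x = 0 ↔ x ∈ G.carrier X :=
  QuotientAddGroup.eq_zero_iff x

theorem Sub.toQuotient_surjective {F : C ⥤ AddCommGrpCat.{v}} (G : Sub F) (X : C) :
    Function.Surjective (G.toQuotient.app X) :=
  QuotientAddGroup.mk'_surjective _

variable [Preadditive C]

instance Sub.quotient_additive {F : C ⥤ AddCommGrpCat.{v}} [F.Additive] (G : Sub F) :
    G.quotient.Additive where
  map_add {_ Y f g} := AddCommGrpCat.hom_ext <| QuotientAddGroup.addMonoidHom_ext _ <|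
    AddMonoidHom.ext fun x => congrArg (QuotientAddGroup.mk' (G.carrier Y))
      (ConcreteCategory.congr_hom (F.map_add (f := f) (g := g)) x)

/-- An epimorphism equalizes the projection onto its pointwise cokernel with the zero map, so that
cokernel vanishes. -/
theorem surjective_of_epi {F G : C ⥤+ AddCommGrpCat.{v}} (φ : F ⟶ G) [Epi φ] (X : C) :
    Function.Surjective (φ.hom.app X) := by
  intro y
  let Q : C ⥤+ AddCommGrpCat.{v} := AdditiveFunctor.of (Sub.range φ.hom).quotient
  let p : G ⟶ Q := ⟨(Sub.range φ.hom).toQuotient⟩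
  let z : G ⟶ Q := ⟨0⟩
  have h : p = z := by
    rw [← cancel_epi φ]
    ext Y x
    exact (Sub.toQuotient_eq_zero_iff _ _).2 ⟨x, rfl⟩
  have h' : p.hom.app X y = z.hom.app X y := by rw [h]
  exact (Sub.toQuotient_eq_zero_iff _ _).1 h'

theorem epi_of_surjective {F G : C ⥤+ AddCommGrpCat.{v}} (φ : F ⟶ G)
    (h : ∀ X, Function.Surjective (φ.hom.app X)) : Epi φ where
  left_cancellation a b hab := by
    ext X y
    obtain ⟨x, rfl⟩ := h X y
    have h' : (φ ≫ a).hom.app X x = (φ ≫ b).hom.app X x := by rw [hab]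
    exact h'

namespace TwoSidedIdeal

variable (J : TwoSidedIdeal C) {X E : C} {x : X ⟶ E}

/-- The assignment `x ≫ s ↦ e ≫ s` is well defined by `hker` and splits the surjection `C(E,-) →
J(X,-)`. The lift through `p` is written directly: take a preimage `n` of `f x` and send `x ≫ s` to
`N(e ≫ s) n`; since `x ≫ e = x`, this lies over `f`. -/
theorem projective_row_of_generator (hx : x ∈ J.hom X E)
    (hgen : ∀ (Y : C), ∀ y ∈ J.hom X Y, ∃ s : E ⟶ Y, y = x ≫ s)
    (e : E ⟶ E) (he : x ≫ e = x) (hker : ∀ (Y : C) (s : E ⟶ Y), x ≫ s = 0 → e ≫ s = 0) :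
    Projective (AdditiveFunctor.of (J.row X).toFunctor) where
  factors {N Q} f p _ := by
    obtain ⟨n, hn⟩ := surjective_of_epi p E (f.hom.app E ⟨x, hx⟩)
    choose s hs using hgen
    have key : ∀ {Y : C} (a b : E ⟶ Y), x ≫ a = x ≫ b → e ≫ a = e ≫ b := by
      intro Y a b h
      rw [← sub_eq_zero, ← Preadditive.comp_sub] at h ⊢
      exact hker _ _ h
    let l : ∀ Y, J.hom X Y →+ N.obj.obj Y := fun Y =>
      AddMonoidHom.mk' (fun y => N.obj.map (e ≫ s Y y.1 y.2) n) (by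
        intro a b
        rw [key (s Y _ (a + b).2) (s Y _ a.2 + s Y _ b.2) (by
          rw [Preadditive.comp_add, ← hs, ← hs, ← hs]; rfl), Preadditive.comp_add,
          Functor.map_add]
        rfl)
    refine ⟨⟨⟨fun Y => AddCommGrpCat.ofHom (l Y), ?_⟩⟩, ?_⟩
    · intro Y Z g
      ext y
      change N.obj.map (e ≫ s Z (y.1 ≫ g) _) n = N.obj.map g (N.obj.map (e ≫ s Y y.1 y.2) n)
      rw [key (s Z (y.1 ≫ g) (J.comp_mem _ _ y.2)) (s Y y.1 y.2 ≫ g) (by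
        exact (hs _ _ _).symm.trans ((congrArg (· ≫ g) (hs Y y.1 y.2)).trans
          (Category.assoc _ _ _))), ← Category.assoc, N.obj.map_comp]
      rfl
    · ext Y y
      change p.hom.app Y (N.obj.map (e ≫ s Y y.1 y.2) n) = f.hom.app Y y
      have h1 := ConcreteCategory.congr_hom (p.hom.naturality (e ≫ s Y y.1 y.2)) n
      have h2 := ConcreteCategory.congr_hom (f.hom.naturality (e ≫ s Y y.1 y.2)) ⟨x, hx⟩
      refine h1.trans ?_
      change Q.obj.map _ (p.hom.app E n) = _
      rw [hn]
      refine h2.symm.trans ?_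
      change f.hom.app Y ⟨x ≫ e ≫ s Y y.1 y.2, _⟩ = _
      congr 1
      refine Subtype.ext ?_
      change x ≫ e ≫ s Y y.1 y.2 = y.1
      rw [← Category.assoc, he]
      exact (hs Y y.1 y.2).symm

/-- The surjection `s ↦ x ≫ s` from `C(E,-)` splits, and `e` is the value of the splitting at `x`;
both properties follow by Yoneda. -/
theorem exists_of_projective_row (hx : x ∈ J.hom X E)
    (hgen : ∀ (Y : C), ∀ y ∈ J.hom X Y, ∃ s : E ⟶ Y, y = x ≫ s)
    [Projective (AdditiveFunctor.of (J.row X).toFunctor)] :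
    ∃ e : E ⟶ E, x ≫ e = x ∧ ∀ (Y : C) (s : E ⟶ Y), x ≫ s = 0 → e ≫ s = 0 := by
  let P := AdditiveFunctor.of (J.row X).toFunctor
  let R := AdditiveFunctor.of (preadditiveCoyoneda.obj (op E))
  let l : ∀ Y, (E ⟶ Y) →+ J.hom X Y := fun Y =>
    AddMonoidHom.mk' (fun s => ⟨x ≫ s, J.comp_mem _ _ hx⟩)
      fun a b => Subtype.ext (Preadditive.comp_add _ _ _ _ _ _)
  let p : R ⟶ P := ⟨{
    app := fun Y => AddCommGrpCat.ofHom (l Y)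
    naturality := fun Y Z g => by
      ext s
      exact Subtype.ext (Category.assoc _ _ _).symm }⟩
  have : Epi p := epi_of_surjective p fun Y y => by
    obtain ⟨s, hs⟩ := hgen Y y.1 y.2
    exact ⟨s, Subtype.ext hs.symm⟩
  let σ : P ⟶ R := Projective.factorThru (𝟙 P) p
  have hσ : σ ≫ p = 𝟙 P := Projective.factorThru_comp _ _
  let ξ : P.obj.obj E := (⟨x, hx⟩ : J.hom X E)
  let e : E ⟶ E := σ.hom.app E ξ
  have nat : ∀ (Y : C) (s : E ⟶ Y), e ≫ s = σ.hom.app Y (⟨x ≫ s, J.comp_mem _ _ hx⟩ : J.hom X Y) :=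
    fun Y s => (ConcreteCategory.congr_hom (σ.hom.naturality s) ξ).symm
  refine ⟨e, ?_, fun Y s h => ?_⟩
  · have h : (σ ≫ p).hom.app E ξ = (𝟙 P : P ⟶ P).hom.app E ξ := by rw [hσ]
    exact congrArg Subtype.val h
  · rw [nat]
    have : (⟨x ≫ s, J.comp_mem _ _ hx⟩ : J.hom X Y) = 0 := Subtype.ext h
    rw [this]
    exact (σ.hom.app Y).hom.map_zero

end TwoSidedIdeal

end Modules

/-! ### Heredity ideals of quotient categories -/

section Heredity

variable {C : Type u} [Category.{v} C] [Preadditive C]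

namespace TwoSidedIdeal

variable (I J : TwoSidedIdeal C)

theorem proj_map_eq_iff {X Y : C} (f g : X ⟶ Y) :
    I.proj.map f = I.proj.map g ↔ f - g ∈ I.hom X Y :=
  CategoryTheory.Quotient.functor_map_eq_iff _ _ _

theorem proj_map_eq_zero_iff {X Y : C} (f : X ⟶ Y) : I.proj.map f = 0 ↔ f ∈ I.hom X Y := by
  rw [← I.proj.map_zero, proj_map_eq_iff, sub_zero]

/-- The class of `h` in `C / I` is radical. -/
def IsRadicalMod {X Y : C} (h : X ⟶ Y) : Prop :=
  ∀ g : Y ⟶ X, ∃ k : X ⟶ X, (𝟙 X - h ≫ g) ≫ k - 𝟙 X ∈ I.hom X X ∧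
    k ≫ (𝟙 X - h ≫ g) - 𝟙 X ∈ I.hom X X

theorem isRadical_proj_map_iff {X Y : C} (h : X ⟶ Y) :
    IsRadical (I.proj.map h) ↔ I.IsRadicalMod h := by
  constructor
  · intro H g
    obtain ⟨k, hk₁, hk₂⟩ := H (I.proj.map g)
    obtain ⟨k, rfl⟩ := I.proj.map_surjective k
    rw [← I.proj.map_comp, ← I.proj.map_id, ← I.proj.map_sub, ← I.proj.map_comp,
      proj_map_eq_iff] at hk₁ hk₂
    exact ⟨k, hk₁, hk₂⟩
  · intro H g
    obtain ⟨g, rfl⟩ := I.proj.map_surjective g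
    obtain ⟨k, hk₁, hk₂⟩ := H g
    rw [← proj_map_eq_iff] at hk₁ hk₂
    exact ⟨I.proj.map k, by
      rwa [← I.proj.map_comp, ← I.proj.map_id, ← I.proj.map_sub, ← I.proj.map_comp], by
      rwa [← I.proj.map_comp, ← I.proj.map_id, ← I.proj.map_sub, ← I.proj.map_comp]⟩

/-- The module `J(X,-) / I(X,-)` over `C / I` is generated by an element `x`, which the
idempotent `e` of `C / I` splits off a representable module. -/
def IsProjectiveMod (X : C) : Prop :=
  ∃ (E : C) (x : X ⟶ E) (e : E ⟶ E), x ∈ J.hom X E ∧ x ≫ e - x ∈ I.hom X E ∧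
    (∀ (Y : C), ∀ y ∈ J.hom X Y, ∃ s : E ⟶ Y, y - x ≫ s ∈ I.hom X Y) ∧
    ∀ (Y : C) (s : E ⟶ Y), x ≫ s ∈ I.hom X Y → e ≫ s ∈ I.hom E Y

variable {I J} in
theorem mem_modIdeal {X Y : C} {f : X ⟶ Y} (hf : f ∈ J.hom X Y) :
    I.proj.map f ∈ (J.modIdeal I).hom (I.proj.obj X) (I.proj.obj Y) := ⟨f, hf, rfl⟩

theorem IsProjectiveMod.projective {X : C} (h : I.IsProjectiveMod J X) :
    Projective (AdditiveFunctor.of ((J.modIdeal I).row (I.proj.obj X)).toFunctor) := by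
  obtain ⟨E, x, e, hx, he, hgen, hker⟩ := h
  refine projective_row_of_generator (x := I.proj.map x) (E := I.proj.obj E) _
    (mem_modIdeal hx) ?_ (I.proj.map e) ?_ ?_
  · rintro Y _ ⟨y, hy, rfl⟩
    obtain ⟨s, hs⟩ := hgen _ y hy
    refine ⟨I.proj.map s, ?_⟩
    rw [← I.proj.map_comp]
    exact (proj_map_eq_iff _ _ _).2 hs
  · rw [← I.proj.map_comp, proj_map_eq_iff]
    exact he
  · intro Y s hs
    obtain ⟨s, rfl⟩ := I.proj.map_surjective (Y := Y.as) s
    have hs' : I.proj.map (x ≫ s) = 0 := (I.proj.map_comp _ _).trans hs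
    exact (I.proj.map_comp _ _).symm.trans
      ((proj_map_eq_zero_iff _ _).2 (hker _ _ ((proj_map_eq_zero_iff _ _).1 hs')))

theorem IsProjectiveMod.finGen {X : C} (h : I.IsProjectiveMod J X) :
    IsFinGen ((J.modIdeal I).row (I.proj.obj X)).toFunctor := by
  obtain ⟨E, x, e, hx, he, hgen, hker⟩ := h
  refine ⟨1, fun _ => I.proj.obj E, fun _ => ⟨I.proj.map x, mem_modIdeal hx⟩, ?_⟩
  rintro Y ⟨_, y, hy, rfl⟩
  obtain ⟨s, hs⟩ := hgen _ y hy
  refine ⟨fun _ => I.proj.map s, ?_⟩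
  rw [Fin.sum_univ_one]
  refine Subtype.ext ?_
  exact ((proj_map_eq_iff _ _ _).2 hs).trans (I.proj.map_comp _ _)

/-- Finitely many generators, lifted to `C`, are the components of a single morphism `ξ` into the
direct sum of their targets. The splitting of this one generator then gives `e`. -/
theorem IsProjectiveMod.of_isHeredity [HasFiniteBiproducts C] (h : (J.modIdeal I).IsHeredity)
    (X : C) : I.IsProjectiveMod J X := by
  have hp := h.projective (I.proj.obj X)
  obtain ⟨n, E, x, hgen⟩ := h.finGen (I.proj.obj X)
  choose x' hx' hx'' using fun i => (x i).2
  let ξ : X ⟶ ⨁ fun i => (E i).as := ∑ i, x' i ≫ biproduct.ι (fun i => (E i).as) i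
  have hξ : ξ ∈ J.hom _ _ := sum_mem fun i _ => J.comp_mem _ _ (hx' i)
  have hgen' : ∀ Y : C, ∀ y ∈ J.hom X Y, ∃ s, y - ξ ≫ s ∈ I.hom X Y := by
    intro Y y hy
    obtain ⟨s, hs⟩ := hgen (I.proj.obj Y) ⟨I.proj.map y, mem_modIdeal hy⟩
    choose s' hs' using fun i => I.proj.map_surjective (X := (E i).as) (Y := Y) (s i)
    refine ⟨biproduct.desc s', ?_⟩
    have h1 : ξ ≫ biproduct.desc s' = ∑ i, x' i ≫ s' i := by
      simp [ξ, Preadditive.sum_comp]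
    rw [← proj_map_eq_iff, h1, I.proj.map_sum]
    have h2 := congrArg (((J.modIdeal I).row (I.proj.obj X)).carrier (I.proj.obj Y)).subtype hs
    refine (h2.trans (map_sum (AddSubgroup.subtype _) _ _)).trans ?_
    refine Finset.sum_congr rfl fun i _ => ?_
    rw [I.proj.map_comp, hs']
    exact congrArg (· ≫ s i) (hx'' i).symm
  obtain ⟨e, he, hker⟩ := (J.modIdeal I).exists_of_projective_row (x := I.proj.map ξ)
    (mem_modIdeal hξ) (by
      rintro Y _ ⟨y, hy, rfl⟩
      obtain ⟨s, hs⟩ := hgen' _ y hy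
      exact ⟨I.proj.map s, ((proj_map_eq_iff _ _ _).2 hs).trans (I.proj.map_comp _ _)⟩)
  obtain ⟨e, rfl⟩ := I.proj.map_surjective e
  refine ⟨_, ξ, e, hξ, ?_, hgen', fun Y s hs => ?_⟩
  · rwa [← proj_map_eq_iff, I.proj.map_comp]
  · rw [← proj_map_eq_zero_iff, I.proj.map_comp] at hs ⊢
    exact hker _ _ hs

end TwoSidedIdeal

variable [HasFiniteBiproducts C] {B B' : ObjectProperty C} {hB : IsAdditiveSubcat B}
  {hB' : IsAdditiveSubcat B'}

theorem mem_factorIdeal_of_left {X Y : C} (h : B X) (f : X ⟶ Y) :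
    f ∈ (factorIdeal B hB).hom X Y := ⟨X, h, 𝟙 X, f, Category.id_comp f⟩

theorem mem_factorIdeal_of_right {X Y : C} (h : B Y) (f : X ⟶ Y) :
    f ∈ (factorIdeal B hB).hom X Y := ⟨Y, h, f, 𝟙 Y, Category.comp_id f⟩

-- In a product from `J · rad · J`, only the middle segment between the two objects of `B'` through
-- which the outer factors pass matters, and that segment is again radical modulo the smaller ideal.
open QHCat.TwoSidedIdeal in
theorem isHeredity_factorIdeal
    (hrad : ∀ ⦃X Y : C⦄ (h : X ⟶ Y), B' X → B' Y → (factorIdeal B hB).IsRadicalMod h →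
      h ∈ (factorIdeal B hB).hom X Y)
    (hproj : ∀ X : C, (factorIdeal B hB).IsProjectiveMod (factorIdeal B' hB') X) :
    ((factorIdeal B' hB').modIdeal (factorIdeal B hB)).IsHeredity where
  idempotent X Y := by
    let I := factorIdeal B hB
    refine le_antisymm ?_ ((AddSubgroup.closure_le _).2 ?_)
    · rintro _ ⟨_, ⟨Z, hZ, r, s, rfl⟩, rfl⟩
      exact AddSubgroup.subset_closure ⟨I.proj.obj Z, I.proj.map r, I.proj.map s,
        mem_modIdeal (mem_factorIdeal_of_right hZ r), mem_modIdeal (mem_factorIdeal_of_left hZ s),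
        (I.proj.map_comp r s).symm⟩
    · rintro _ ⟨Z, f, g, hf, -, rfl⟩
      exact TwoSidedIdeal.comp_mem _ f g hf
  rad {W X Y Z} f h g hf hh hg := by
    let I := factorIdeal B hB
    obtain ⟨_, ⟨P, hP, a, b, rfl⟩, rfl⟩ := hf
    obtain ⟨_, ⟨Q, hQ, c, d, rfl⟩, rfl⟩ := hg
    obtain ⟨h, rfl⟩ := (factorIdeal B hB).proj.map_surjective (X := X.as) (Y := Y.as) h
    have hh' : I.IsRadicalMod h := (I.isRadical_proj_map_iff h).1 hh
    have key : b ≫ h ≫ c ∈ I.hom P Q := by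
      refine hrad _ hP hQ fun g => ?_
      obtain ⟨k, hk₁, hk₂⟩ := hh' (c ≫ g ≫ b)
      -- This is the usual passage from an inverse of `1 - vu` to one of `1 - uv`, with `u = b` and
      -- `v = h ≫ c ≫ g`: an inverse `k` of the former yields `1 + b ≫ k ≫ v`, modulo `I`.
      have e₁ : (𝟙 P - (b ≫ h ≫ c) ≫ g) ≫ (𝟙 P + b ≫ k ≫ h ≫ c ≫ g) - 𝟙 P =
          b ≫ ((𝟙 _ - h ≫ c ≫ g ≫ b) ≫ k - 𝟙 _) ≫ h ≫ c ≫ g := by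
        simp only [Preadditive.comp_sub, Preadditive.sub_comp, Preadditive.comp_add,
          Category.assoc, Category.comp_id, Category.id_comp]
        abel
      have e₂ : (𝟙 P + b ≫ k ≫ h ≫ c ≫ g) ≫ (𝟙 P - (b ≫ h ≫ c) ≫ g) - 𝟙 P =
          b ≫ (k ≫ (𝟙 _ - h ≫ c ≫ g ≫ b) - 𝟙 _) ≫ h ≫ c ≫ g := by
        simp only [Preadditive.comp_sub, Preadditive.sub_comp, Preadditive.add_comp,
          Category.assoc, Category.comp_id, Category.id_comp]
        abel
      exact ⟨_, e₁ ▸ I.mem_comp _ _ (I.comp_mem _ _ hk₁), e₂ ▸ I.mem_comp _ _ (I.comp_mem _ _ hk₂)⟩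
    change I.proj.map (a ≫ b) ≫ I.proj.map h ≫ I.proj.map (c ≫ d) = 0
    rw [← I.proj.map_comp, ← I.proj.map_comp, proj_map_eq_zero_iff]
    have := I.comp_mem _ d (I.mem_comp a _ key)
    simpa using this
  projective X := (hproj X.as).projective
  finGen X := (hproj X.as).finGen

-- The identities of `X` and `Y` belong to the larger ideal, so `J · rad · J = 0` applies to `𝟙 X ≫
-- h ≫ 𝟙 Y`.
open QHCat.TwoSidedIdeal in
theorem mem_of_isRadicalMod
    (H : ((factorIdeal B' hB').modIdeal (factorIdeal B hB)).IsHeredity) {X Y : C} (h : X ⟶ Y)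
    (hX : B' X) (hY : B' Y) (hh : (factorIdeal B hB).IsRadicalMod h) :
    h ∈ (factorIdeal B hB).hom X Y := by
  have := H.rad _ _ _ (mem_modIdeal (mem_factorIdeal_of_left hX (𝟙 X)))
    ((isRadical_proj_map_iff _ h).2 hh) (mem_modIdeal (mem_factorIdeal_of_left hY (𝟙 Y)))
  rwa [← Functor.map_comp, ← Functor.map_comp, Category.id_comp, Category.comp_id,
    proj_map_eq_zero_iff] at this

end Heredity

/-! ### Traces and `Δ`-filtered modules -/

section Trace

variable {C : Type u} [Category.{v} C]

theorem natTrans_sum_apply {F G : C ⥤ AddCommGrpCat.{v}} {ι : Type*} [Fintype ι]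
    (η : ι → (F ⟶ G)) {X : C} (x : F.obj X) :
    (∑ i, η i).app X x = ∑ i, (η i).app X x :=
  map_sum (AddMonoidHom.mk' (fun θ : F ⟶ G => θ.app X x) fun _ _ => rfl) η Finset.univ

variable [Preadditive C]

/-- The morphism `C(E,-) ⟶ F` that sends the identity of `E` to `m`. -/
def ofElement (F : C ⥤ AddCommGrpCat.{v}) [F.Additive] {E : C} (m : F.obj E) :
    preadditiveCoyoneda.obj (op E) ⟶ F where
  app Y := AddCommGrpCat.ofHom (AddMonoidHom.mk' (fun s : E ⟶ Y => F.map s m) fun s t =>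
    ConcreteCategory.congr_hom (F.map_add (f := s) (g := t)) m)
  naturality Y Z g := by
    ext s
    exact ConcreteCategory.congr_hom (F.map_comp s g) m

theorem map_mem_trace {B : ObjectProperty C} (F : C ⥤ AddCommGrpCat.{v}) [F.Additive] {E Y : C}
    (hE : B E) (m : F.obj E) (s : E ⟶ Y) : F.map s m ∈ (trace B F).carrier Y :=
  AddSubgroup.mem_iSup_of_mem E (AddSubgroup.mem_iSup_of_mem hE
    (AddSubgroup.mem_iSup_of_mem (ofElement F m) ⟨s, rfl⟩))

/-- By Yoneda, elements of the image of one morphism `C(E,-) ⟶ F` have this form; direct sums in `B`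
merge two such elements into one, so no sums are needed. -/
theorem mem_trace_iff [HasFiniteBiproducts C] {B : ObjectProperty C} (hB : IsAdditiveSubcat B)
    (F : C ⥤ AddCommGrpCat.{v}) [F.Additive] {Y : C} (y : F.obj Y) :
    y ∈ (trace B F).carrier Y ↔
      ∃ (E : C) (_ : B E) (m : F.obj E) (s : E ⟶ Y), F.map s m = y := by
  constructor
  · let H : AddSubgroup (F.obj Y) :=
      { carrier := {y | ∃ (E : C) (_ : B E) (m : F.obj E) (s : E ⟶ Y), F.map s m = y}
        zero_mem' := by
          obtain ⟨Z, hZ, -⟩ := hB.exists_zero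
          exact ⟨Z, hZ, 0, 0, map_zero _⟩
        add_mem' := by
          rintro _ _ ⟨E, hE, m, s, rfl⟩ ⟨E', hE', m', s', rfl⟩
          obtain ⟨W, hW, ⟨e⟩⟩ := hB.exists_biprod E E' hE hE'
          refine ⟨W, hW, F.map (biprod.inl ≫ e.inv) m + F.map (biprod.inr ≫ e.inv) m',
            e.hom ≫ biprod.desc s s', ?_⟩
          rw [map_add, ← ConcreteCategory.comp_apply, ← ConcreteCategory.comp_apply,
            ← F.map_comp, ← F.map_comp]
          simp
        neg_mem' := by
          rintro _ ⟨E, hE, m, s, rfl⟩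
          exact ⟨E, hE, -m, s, map_neg _ _⟩ }
    suffices h : (trace B F).carrier Y ≤ H from fun hy => h hy
    refine iSup_le fun E => iSup_le fun hE => iSup_le fun η => ?_
    rintro _ ⟨s, rfl⟩
    refine ⟨E, hE, η.app E (𝟙 E), s, ?_⟩
    refine (ConcreteCategory.congr_hom (η.naturality s) (𝟙 E)).symm.trans ?_
    exact congrArg (η.app Y).hom (Category.id_comp s)
  · rintro ⟨E, hE, m, s, rfl⟩
    exact map_mem_trace F hE m s

variable [HasFiniteBiproducts C]

/-- The factor `F^[j+1] / F^[j]` of a `Δ`-filtered module is generated by one element, whose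
annihilator is the ideal `I_{B j}`. -/
theorem IsDeltaFiltered.exists_generator {B : ℕ → ObjectProperty C}
    {hB : ∀ j, IsAdditiveSubcat (B j)} {F : C ⥤ AddCommGrpCat.{v}} [F.Additive]
    (hF : IsDeltaFiltered B hB F) (j : ℕ) :
    ∃ (E : C) (m : F.obj E), m ∈ (trace (B (j + 1)) F).carrier E ∧
      (∀ (Y : C), ∀ y ∈ (trace (B (j + 1)) F).carrier Y, ∃ s : E ⟶ Y,
        y - F.map s m ∈ (trace (B j) F).carrier Y) ∧
      ∀ (Y : C) (s : E ⟶ Y), F.map s m ∈ (trace (B j) F).carrier Y →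
        s ∈ (factorIdeal (B j) (hB j)).hom E Y := by
  obtain ⟨k, E, -, ⟨φ⟩⟩ := hF j
  set G := trace (B j) F
  set H := trace (B (j + 1)) F
  set I := factorIdeal (B j) (hB j)
  let S : Fin k → (C ⥤ AddCommGrpCat.{v}) := fun i => (I.row (E i)).quotient
  let Q := (G.restrict H).quotient
  let φ : Q ≅ ⨁ S := φ
  let cls : ∀ {i : Fin k} {Y : C}, (E i ⟶ Y) → (S i).obj Y := fun {i Y} s =>
    (I.row (E i)).toQuotient.app Y s
  have cls_zero : ∀ {i : Fin k} {Y : C} (s : E i ⟶ Y), cls s = 0 ↔ s ∈ I.hom (E i) Y :=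
    fun {i _} s => (I.row (E i)).toQuotient_eq_zero_iff s
  have cls_map : ∀ {i : Fin k} {Y : C} (s : E i ⟶ Y), (S i).map s (cls (𝟙 (E i))) = cls s :=
    fun {i Y} s => congrArg ((I.row (E i)).toQuotient.app Y) (Category.id_comp s)
  let q : ∀ Y, H.carrier Y → Q.obj Y := fun Y y =>
    (G.restrict H).toQuotient.app Y y
  have q_surj : ∀ Y, Function.Surjective (q Y) := (G.restrict H).toQuotient_surjective
  let ψ : ∀ i, S i ⟶ Q := fun i => biproduct.ι S i ≫ φ.inv
  let π : ∀ i, Q ⟶ S i := fun i => φ.hom ≫ biproduct.π S i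
  have πψ : ∑ i, π i ≫ ψ i = 𝟙 Q := by
    have h : ∀ i, π i ≫ ψ i = φ.hom ≫ (biproduct.π S i ≫ biproduct.ι S i) ≫ φ.inv := by
      intro i
      simp only [π, ψ, Category.assoc]
    simp_rw [h]
    rw [← Preadditive.comp_sum, ← Preadditive.sum_comp, biproduct.total, Category.id_comp,
      Iso.hom_inv_id]
  have ψπ : ∀ i, ψ i ≫ π i = 𝟙 _ := fun i => by simp [π, ψ]
  have ψπ_ne : ∀ i i', i ≠ i' → ψ i ≫ π i' = 0 := fun i i' h => by
    simp [π, ψ, biproduct.ι_π_ne _ h]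
  -- Lift the canonical generators of the standard summands to `F^[j+1]`; their sum over `⨁ E` is
  -- the single generator.
  choose z hz using fun i => q_surj (E i) ((ψ i).app (E i) (cls (𝟙 (E i))))
  let m : F.obj (⨁ E) := ∑ i, F.map (biproduct.ι E i) (z i).1
  have hm : m ∈ H.carrier (⨁ E) := sum_mem fun i _ => H.map_mem _ _ (z i).2
  have hFm : ∀ {Y : C} (s : ⨁ E ⟶ Y), F.map s m = ∑ i, F.map (biproduct.ι E i ≫ s) (z i).1 := by
    intro Y s
    simp only [m, map_sum, F.map_comp]
    rfl
  -- Modulo `F^[j]`, the action of `s` on `m` is the tuple of classes of the components of `s` in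
  -- the standard modules.
  have hqm : ∀ {Y : C} (s : ⨁ E ⟶ Y), q Y ⟨F.map s m, H.map_mem _ _ hm⟩ =
      ∑ i, (ψ i).app Y (cls (biproduct.ι E i ≫ s)) := by
    intro Y s
    have h₁ : (⟨F.map s m, H.map_mem _ _ hm⟩ : H.carrier Y) =
        ∑ i, H.toFunctor.map (biproduct.ι E i ≫ s) (z i) := by
      refine Subtype.ext ((hFm s).trans ?_)
      exact (map_sum (H.carrier Y).subtype
        (fun i => (H.toFunctor.map (biproduct.ι E i ≫ s) (z i) : H.carrier Y)) Finset.univ).symm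
    rw [h₁]
    refine (map_sum ((G.restrict H).toQuotient.app Y).hom _ _).trans
      (Finset.sum_congr rfl fun i _ => ?_)
    refine (ConcreteCategory.congr_hom
      ((G.restrict H).toQuotient.naturality (biproduct.ι E i ≫ s)) (z i)).trans ?_
    refine (congrArg (Q.map (biproduct.ι E i ≫ s)) (hz i)).trans ?_
    refine (ConcreteCategory.congr_hom ((ψ i).naturality (biproduct.ι E i ≫ s)) _).symm.trans ?_
    exact congrArg ((ψ i).app Y) (cls_map _)
  refine ⟨⨁ E, m, hm, fun Y y hy => ?_, fun Y s hs => ?_⟩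
  · have hex : ∀ i, ∃ s : E i ⟶ Y, cls s = (π i).app Y (q Y ⟨y, hy⟩) := fun i =>
      (I.row (E i)).toQuotient_surjective Y _
    choose s hs using hex
    refine ⟨biproduct.desc s, ?_⟩
    have h : q Y ⟨F.map (biproduct.desc s) m, H.map_mem _ _ hm⟩ = q Y ⟨y, hy⟩ := by
      rw [hqm]
      have h₁ : ((∑ i, π i ≫ ψ i).app Y) (q Y ⟨y, hy⟩) = q Y ⟨y, hy⟩ := by rw [πψ]; rfl
      rw [natTrans_sum_apply] at h₁
      refine Eq.trans (Finset.sum_congr rfl fun i _ => ?_) h₁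
      rw [biproduct.ι_desc]
      exact congrArg ((ψ i).app Y) (hs i)
    have h' : q Y (⟨y, hy⟩ - ⟨F.map (biproduct.desc s) m, H.map_mem _ _ hm⟩) = 0 := by
      refine (map_sub ((G.restrict H).toQuotient.app Y).hom _ _).trans ?_
      exact sub_eq_zero.2 h.symm
    exact ((G.restrict H).toQuotient_eq_zero_iff _).1 h'
  · have h : ∑ i, (ψ i).app Y (cls (biproduct.ι E i ≫ s)) = 0 := by
      rw [← hqm]
      exact ((G.restrict H).toQuotient_eq_zero_iff _).2 hs
    -- Applying `π i` isolates the `i`-th component, whose vanishing in the standard module is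
    -- membership in `I`.
    have h' : ∀ i, biproduct.ι E i ≫ s ∈ I.hom (E i) Y := by
      intro i
      rw [← cls_zero]
      have h₁ := congrArg ((π i).app Y).hom h
      refine Eq.trans ?_ (h₁.trans (map_zero _))
      rw [map_sum, Finset.sum_eq_single i]
      · exact (ConcreteCategory.congr_hom (congrArg (NatTrans.app · Y) (ψπ i)) _).symm
      · intro i' _ hi'
        exact ConcreteCategory.congr_hom (congrArg (NatTrans.app · Y) (ψπ_ne i' i hi')) _
      · simp
    have h'' : s = ∑ i, biproduct.π E i ≫ biproduct.ι E i ≫ s := by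
      simp_rw [← Category.assoc]
      rw [← Preadditive.sum_comp, biproduct.total, Category.id_comp]
    rw [h'']
    exact sum_mem fun i _ => I.mem_comp _ _ (h' i)

end Trace

/-! ### Subcategories and ideals of triangular matrix categories -/

namespace TriCat

section

variable {K : Type w} [Field K]
  {𝒯 : Type u₁} [Category.{v} 𝒯] [Preadditive 𝒯] [Linear K 𝒯]
  {𝒰 : Type u₂} [Category.{v} 𝒰] [Preadditive 𝒰] [Linear K 𝒰]
  {M : TensorCat K 𝒰 𝒯ᵒᵖ ⥤ ModuleCat.{v} K}

variable (M) in
/-- The objects whose diagonal entries satisfy `BT` and `BU`. -/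
def diag (BT : ObjectProperty 𝒯) (BU : ObjectProperty 𝒰) : ObjectProperty (TriCat M) :=
  fun X => BT X.t ∧ BU X.u

/-- For `j ≤ n`, truncated subtraction gives `j - n = 0`, and `BT 0` is the condition of being a
zero object; for `j > n` the condition on the `𝒰`-entry is vacuous. -/
theorem filtration_eq_diag (n : ℕ) {BT : ℕ → ObjectProperty 𝒯} {BU : ℕ → ObjectProperty 𝒰}
    (hT : ∀ T, BT 0 T ↔ IsZero T) (hU : ∀ U, BU 0 U ↔ IsZero U)
    (hUn : ∀ j, n ≤ j → ∀ U, BU j U) :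
    filtration M n BT BU = fun j => diag M (BT (j - n)) (BU j) := by
  funext j X
  simp only [filtration, diag]
  split_ifs with h₀ h₁
  · subst h₀
    rw [Nat.zero_sub, hT, hU]
  · rw [Nat.sub_eq_zero_of_le h₁, hT]
  · exact propext (iff_self_and.2 fun _ => hUn j (by omega) _)

/-- The trace of the modules `𝒰(E,-)`, `E` in `BU`, in `M_T`, evaluated at `U`. -/
def columnTrace (M : TensorCat K 𝒰 𝒯ᵒᵖ ⥤ ModuleCat.{v} K) (BU : ObjectProperty 𝒰)
    (T : 𝒯) (U : 𝒰) : AddSubgroup (M.obj ⟨U, op T⟩) :=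
  (trace BU (column M T)).carrier U

variable {BU : ObjectProperty 𝒰}

theorem actU_mem_columnTrace_of_mem {T : 𝒯} {U U' : 𝒰} (g : U ⟶ U') {m : M.obj ⟨U, op T⟩}
    (hm : m ∈ columnTrace M BU T U) : actU g m ∈ columnTrace M BU T U' :=
  (trace BU (column M T)).map_mem g m hm

variable [M.Additive]

instance column_additive (T : 𝒯) : (column M T).Additive where
  map_add {_ _ g g'} := by
    ext m
    exact actU_add (M := M) (T := T) g g' m

theorem zero_actT {T T' : 𝒯} {U : 𝒰} (m : M.obj ⟨U, op T'⟩) : actT (0 : T ⟶ T') m = 0 := by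
  have h := actT_add (0 : T ⟶ T') 0 m
  rwa [add_zero, left_eq_add] at h

theorem zero_actU {T : 𝒯} {U U' : 𝒰} (m : M.obj ⟨U, op T⟩) : actU (0 : U ⟶ U') m = 0 := by
  have h := actU_add (0 : U ⟶ U') 0 m
  rwa [add_zero, left_eq_add] at h

theorem eq_zero_of_isZero_left {T : 𝒯} {U : 𝒰} (hU : IsZero U) (m : M.obj ⟨U, op T⟩) : m = 0 := by
  rw [← actU_id m, hU.eq_of_src (𝟙 U) 0, zero_actU]

theorem eq_zero_of_isZero_right {T : 𝒯} {U : 𝒰} (hT : IsZero T) (m : M.obj ⟨U, op T⟩) :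
    m = 0 := by
  rw [← actT_id m, hT.eq_of_src (𝟙 T) 0, zero_actT]

variable (M) in
/-- The projection onto the upper left corner. -/
@[simps]
def fstFunctor : TriCat M ⥤ 𝒯 where
  obj X := X.t
  map p := p.1

variable (M) in
/-- The projection onto the lower right corner. -/
@[simps]
def sndFunctor : TriCat M ⥤ 𝒰 where
  obj X := X.u
  map p := p.2.2

instance : (fstFunctor M).Additive where
instance : (sndFunctor M).Additive where

/-- Isomorphisms of the diagonal entries define an isomorphism. -/
def isoMk {X Y : TriCat M} (e : X.t ≅ Y.t) (e' : X.u ≅ Y.u) : X ≅ Y where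
  hom := mkHom e.hom 0 e'.hom
  inv := mkHom e.inv 0 e'.inv
  hom_inv_id := by rw [mkHom_comp]; simp [id_eq]
  inv_hom_id := by rw [mkHom_comp]; simp [id_eq]

theorem isZero_iff {X : TriCat M} : IsZero X ↔ IsZero X.t ∧ IsZero X.u := by
  constructor
  · intro h
    exact ⟨(fstFunctor M).map_isZero h, (sndFunctor M).map_isZero h⟩
  · rintro ⟨h, h'⟩
    rw [IsZero.iff_id_eq_zero] at h h' ⊢
    rw [id_eq, h, h', mkHom_zero]

theorem actU_mem_columnTrace {T : 𝒯} {E U : 𝒰} (hE : BU E) (s : E ⟶ U) (m : M.obj ⟨E, op T⟩) :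
    actU s m ∈ columnTrace M BU T U :=
  map_mem_trace (column M T) hE m s

theorem mem_columnTrace_of_forall (hBU : ∀ U, BU U) {T : 𝒯} {U : 𝒰} (m : M.obj ⟨U, op T⟩) :
    m ∈ columnTrace M BU T U := by
  rw [← actU_id m]
  exact actU_mem_columnTrace (hBU U) _ _

theorem mem_columnTrace_iff [HasFiniteBiproducts 𝒰] (hBU : IsAdditiveSubcat BU) {T : 𝒯} {U : 𝒰} {m : M.obj ⟨U, op T⟩} :
    m ∈ columnTrace M BU T U ↔
      ∃ (E : 𝒰) (_ : BU E) (m' : M.obj ⟨E, op T⟩) (s : E ⟶ U), actU s m' = m :=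
  mem_trace_iff hBU (column M T) m

variable [HasFiniteBiproducts 𝒯] [HasFiniteBiproducts 𝒰]

instance : PreservesBinaryBiproducts (fstFunctor M) :=
  preservesBinaryBiproducts_of_preservesBiproducts _

instance : PreservesBinaryBiproducts (sndFunctor M) :=
  preservesBinaryBiproducts_of_preservesBiproducts _

theorem isAdditivelyClosed_diag {BT : ObjectProperty 𝒯} {BU : ObjectProperty 𝒰}
    (hBT : IsAdditivelyClosed BT) (hBU : IsAdditivelyClosed BU) :
    IsAdditivelyClosed (diag M BT BU) where
  exists_zero := by
    obtain ⟨Z, hZ, hZ'⟩ := hBT.exists_zero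
    obtain ⟨W, hW, hW'⟩ := hBU.exists_zero
    exact ⟨⟨Z, W⟩, ⟨hZ, hW⟩, isZero_iff.2 ⟨hZ', hW'⟩⟩
  exists_biprod X Y hX hY := by
    obtain ⟨Z, hZ, ⟨e⟩⟩ := hBT.exists_biprod X.t Y.t hX.1 hY.1
    obtain ⟨W, hW, ⟨e'⟩⟩ := hBU.exists_biprod X.u Y.u hX.2 hY.2
    exact ⟨⟨Z, W⟩, ⟨hZ, hW⟩, ⟨isoMk (e ≪≫ ((fstFunctor M).mapBiprod X Y).symm)
      (e' ≪≫ ((sndFunctor M).mapBiprod X Y).symm)⟩⟩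
  of_iso X Y e h :=
    ⟨hBT.of_iso _ _ ((fstFunctor M).mapIso e) h.1, hBU.of_iso _ _ ((sndFunctor M).mapIso e) h.2⟩
  of_summand X Y h :=
    ⟨hBT.of_summand _ _ (hBT.of_iso _ _ ((fstFunctor M).mapBiprod X Y) h.1),
      hBU.of_summand _ _ (hBU.of_iso _ _ ((sndFunctor M).mapBiprod X Y) h.2)⟩

variable {BT BT' : ObjectProperty 𝒯} {BU' : ObjectProperty 𝒰}

/-- The lower left entry of a composite through `Z` has a term `actU s m'`, which lies in the trace,
and a term `actT r m''`, which need not. `h0` disposes of the latter: either the trace is everything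
or `Z.t` is zero. Conversely, the three entries are factored separately. -/
theorem mem_factorIdeal_diag_iff (hBT : IsAdditiveSubcat BT) (hBU : IsAdditiveSubcat BU)
    (h : IsAdditiveSubcat (diag M BT BU)) (h0 : (∀ U, BU U) ∨ ∀ T, BT T → IsZero T)
    {X Y : TriCat M} (p : X ⟶ Y) :
    p ∈ (factorIdeal (diag M BT BU) h).hom X Y ↔
      p.1 ∈ (factorIdeal BT hBT).hom X.t Y.t ∧ p.2.1 ∈ columnTrace M BU X.t Y.u ∧
        p.2.2 ∈ (factorIdeal BU hBU).hom X.u Y.u := by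
  constructor
  · rintro ⟨Z, ⟨hZ, hZ'⟩, r, s, rfl⟩
    refine ⟨⟨Z.t, hZ, r.1, s.1, rfl⟩, ?_, ⟨Z.u, hZ', r.2.2, s.2.2, rfl⟩⟩
    obtain h0 | h0 := h0
    · exact mem_columnTrace_of_forall h0 _
    · change actT r.1 s.2.1 + actU s.2.2 r.2.1 ∈ _
      rw [eq_zero_of_isZero_right (h0 _ hZ) s.2.1, map_zero, zero_add]
      exact actU_mem_columnTrace hZ' _ _
  · obtain ⟨f, m, g⟩ := p
    rintro ⟨⟨T, hT, r, s, hf⟩, hm, ⟨U, hU, r', s', hg⟩⟩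
    obtain ⟨E, hE, m', g', hm⟩ := (mem_columnTrace_iff hBU).1 hm
    dsimp only at hf hm hg
    have e : ((f, m, g) : X ⟶ Y) = mkHom f 0 0 + mkHom 0 m 0 + mkHom 0 0 g := by
      rw [mkHom_add, mkHom_add]
      simp [mkHom]
    rw [e]
    refine add_mem (add_mem ?_ ?_) ?_
    · refine ⟨⟨T, U⟩, ⟨hT, hU⟩, mkHom r 0 0, mkHom s 0 0, ?_⟩
      rw [mkHom_comp]
      simp [hf]
    · refine ⟨⟨T, E⟩, ⟨hT, hE⟩, mkHom 0 m' 0, mkHom 0 0 g', ?_⟩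
      rw [mkHom_comp]
      simp [hm]
    · refine ⟨⟨T, U⟩, ⟨hT, hU⟩, mkHom 0 0 r', mkHom 0 0 s', ?_⟩
      rw [mkHom_comp]
      simp [hg]

/-- Testing `p` against the matrix with `g` alone in the upper left corner, the corner of a
quasi-inverse is a quasi-inverse of the corner. -/
theorem isRadicalMod_fst (hBT : IsAdditiveSubcat BT) (h : IsAdditiveSubcat (diag M BT BU))
    {X Y : TriCat M} {p : X ⟶ Y} (hp : (factorIdeal (diag M BT BU) h).IsRadicalMod p) :
    (factorIdeal BT hBT).IsRadicalMod p.1 := by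
  intro g
  have key : ∀ {q : X ⟶ X}, q ∈ (factorIdeal (diag M BT BU) h).hom X X →
      q.1 ∈ (factorIdeal BT hBT).hom X.t X.t := by
    rintro _ ⟨Z, hZ, r, s, rfl⟩
    exact ⟨Z.t, hZ.1, r.1, s.1, rfl⟩
  obtain ⟨k, hk₁, hk₂⟩ := hp (mkHom g 0 0)
  exact ⟨k.1, key hk₁, key hk₂⟩

theorem isRadicalMod_snd (hBU : IsAdditiveSubcat BU) (h : IsAdditiveSubcat (diag M BT BU))
    {X Y : TriCat M} {p : X ⟶ Y} (hp : (factorIdeal (diag M BT BU) h).IsRadicalMod p) :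
    (factorIdeal BU hBU).IsRadicalMod p.2.2 := by
  intro g
  have key : ∀ {q : X ⟶ X}, q ∈ (factorIdeal (diag M BT BU) h).hom X X →
      q.2.2 ∈ (factorIdeal BU hBU).hom X.u X.u := by
    rintro _ ⟨Z, hZ, r, s, rfl⟩
    exact ⟨Z.u, hZ.2, r.2.2, s.2.2, rfl⟩
  obtain ⟨k, hk₁, hk₂⟩ := hp (mkHom 0 0 g)
  exact ⟨k.2.2, key hk₁, key hk₂⟩

/-- The row splits into contributions of `𝒯`, of the column `M_T`, and of `𝒰`. The last two are both
acted on through the lower right corner, so their generating objects are added there. -/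
theorem isProjectiveMod_diag (hBT : IsAdditiveSubcat BT) (hBT' : IsAdditiveSubcat BT')
    (hBU : IsAdditiveSubcat BU) (hBU' : IsAdditiveSubcat BU')
    (h : IsAdditiveSubcat (diag M BT BU)) (h' : IsAdditiveSubcat (diag M BT' BU')) (X : TriCat M)
    (h0 : ((∀ U, BU U) ∧ (∀ U, BU' U) ∧
        (factorIdeal BT hBT).IsProjectiveMod (factorIdeal BT' hBT') X.t) ∨
      (∀ T, BT T → IsZero T) ∧ ∀ T, BT' T → IsZero T)
    (hU : (factorIdeal BU hBU).IsProjectiveMod (factorIdeal BU' hBU') X.u)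
    (hM : ∃ (E : 𝒰) (m : M.obj ⟨E, op X.t⟩), m ∈ columnTrace M BU' X.t E ∧
      (∀ U, ∀ y ∈ columnTrace M BU' X.t U, ∃ s : E ⟶ U, y - actU s m ∈ columnTrace M BU X.t U) ∧
      ∀ U (s : E ⟶ U), actU s m ∈ columnTrace M BU X.t U → s ∈ (factorIdeal BU hBU).hom E U) :
    (factorIdeal (diag M BT BU) h).IsProjectiveMod (factorIdeal (diag M BT' BU') h') X := by
  -- Both regimes reduce to projectivity data for `𝒯` together with one extra property: acting on
  -- elements of `M` over `E` by `𝒯` never leaves the trace.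
  have hT₀ : ∃ (E : 𝒯) (x : X.t ⟶ E) (e : E ⟶ E), x ∈ (factorIdeal BT' hBT').hom X.t E ∧
      x ≫ e - x ∈ (factorIdeal BT hBT).hom X.t E ∧
      (∀ (Y : 𝒯), ∀ y ∈ (factorIdeal BT' hBT').hom X.t Y, ∃ s : E ⟶ Y,
        y - x ≫ s ∈ (factorIdeal BT hBT).hom X.t Y) ∧
      (∀ (Y : 𝒯) (s : E ⟶ Y), x ≫ s ∈ (factorIdeal BT hBT).hom X.t Y →
        e ≫ s ∈ (factorIdeal BT hBT).hom E Y) ∧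
      ∀ U (m : M.obj ⟨U, op E⟩) (T : 𝒯) (f : T ⟶ E), actT f m ∈ columnTrace M BU T U := by
    obtain h0 | h0 := h0
    · obtain ⟨h0, -, E, x, e, h₁, h₂, h₃, h₄⟩ := h0
      exact ⟨E, x, e, h₁, h₂, h₃, h₄, fun U m T f => mem_columnTrace_of_forall h0 _⟩
    -- When both `𝒯`-ideals vanish, a zero object with zero generator serves.
    · obtain ⟨Z, hZ, hZ'⟩ := hBT.exists_zero
      refine ⟨Z, 0, 0, zero_mem _, by simp, ?_, ?_, ?_⟩
      · rintro Y _ ⟨W, hW, r, s, rfl⟩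
        refine ⟨0, ?_⟩
        rw [(h0.2 W hW).eq_of_tgt r 0, zero_comp, comp_zero, sub_zero]
        exact zero_mem _
      · intro Y s _
        rw [zero_comp]
        exact zero_mem _
      · intro U m T f
        rw [eq_zero_of_isZero_right hZ' m, map_zero]
        exact zero_mem _
  obtain ⟨ET, x, e, hx, he, hgen, hker, htr⟩ := hT₀
  obtain ⟨EU, x', e', hx', he', hgen', hker'⟩ := hU
  obtain ⟨EM, m, hm, hgenM, hkerM⟩ := hM
  have memI : ∀ {X Y : TriCat M} (p : X ⟶ Y), p ∈ (factorIdeal (diag M BT BU) h).hom X Y ↔ _ :=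
    fun p => mem_factorIdeal_diag_iff hBT hBU h (h0.imp And.left And.left) p
  have memJ : ∀ {X Y : TriCat M} (p : X ⟶ Y), p ∈ (factorIdeal (diag M BT' BU') h').hom X Y ↔ _ :=
    fun p => mem_factorIdeal_diag_iff hBT' hBU' h' (h0.imp (·.2.1) And.right) p
  -- `EM` carries the column generator and `EU` the `𝒰`-generator. On `EM` the idempotent is the
  -- identity, because `hkerM` bounds the annihilator of `m` by the ideal itself.
  let E : TriCat M := ⟨ET, EM ⊞ EU⟩
  let ξ : X ⟶ E := mkHom x (actU biprod.inl m) (x' ≫ biprod.inr)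
  let ε : E ⟶ E := mkHom e 0 (biprod.map (𝟙 EM) e')
  refine ⟨E, ξ, ε, ?_, ?_, fun Y y hy => ?_, fun Y s hs => ?_⟩
  · exact (memJ _).2 ⟨hx, actU_mem_columnTrace_of_mem _ hm, TwoSidedIdeal.comp_mem _ _ _ hx'⟩
  · refine (memI _).2 ⟨he, ?_, ?_⟩
    · change actT x 0 + actU (biprod.map (𝟙 EM) e') (actU biprod.inl m) - actU biprod.inl m ∈ _
      rw [← actU_comp, map_zero, zero_add, biprod.inl_map, Category.id_comp, sub_self]
      exact zero_mem _
    · change (x' ≫ biprod.inr) ≫ biprod.map (𝟙 EM) e' - x' ≫ biprod.inr ∈ _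
      have := TwoSidedIdeal.comp_mem _ _ (biprod.inr : EU ⟶ EM ⊞ EU) he'
      simpa [Preadditive.sub_comp] using this
  · obtain ⟨h₁, h₂, h₃⟩ := (memJ _).1 hy
    obtain ⟨s₁, hs₁⟩ := hgen _ _ h₁
    obtain ⟨s₂, hs₂⟩ := hgenM _ _ h₂
    obtain ⟨s₃, hs₃⟩ := hgen' _ _ h₃
    refine ⟨mkHom s₁ 0 (biprod.desc s₂ s₃), (memI _).2 ⟨hs₁, ?_, ?_⟩⟩
    · change y.2.1 - (actT x 0 + actU (biprod.desc s₂ s₃) (actU biprod.inl m)) ∈ _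
      rwa [← actU_comp, map_zero, zero_add, biprod.inl_desc]
    · change y.2.2 - (x' ≫ biprod.inr) ≫ biprod.desc s₂ s₃ ∈ _
      rwa [Category.assoc, biprod.inr_desc]
  · obtain ⟨f, μ, g⟩ := s
    obtain ⟨h₁, h₂, h₃⟩ := (memI _).1 hs
    change x ≫ f ∈ _ at h₁
    change actT x μ + actU g (actU biprod.inl m) ∈ _ at h₂
    change (x' ≫ biprod.inr) ≫ g ∈ _ at h₃
    -- The unwanted term from `μ` lies in the trace by `htr`, so the condition reduces to one on
    -- `biprod.inl ≫ g`.
    rw [← actU_comp, add_mem_cancel_left (htr _ _ _ _)] at h₂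
    rw [Category.assoc] at h₃
    refine (memI _).2 ⟨hker _ _ h₁, ?_, ?_⟩
    · change actT e μ + actU g 0 ∈ _
      rw [map_zero, add_zero]
      exact htr _ _ _ _
    · change biprod.map (𝟙 EM) e' ≫ g ∈ _
      have h₄ := hkerM _ _ h₂
      have h₅ := hker' _ _ h₃
      have e : biprod.map (𝟙 EM) e' ≫ g =
          biprod.fst ≫ (biprod.inl ≫ g) + biprod.snd ≫ (e' ≫ biprod.inr ≫ g) := by
        ext <;> simp
      rw [e]
      exact add_mem (TwoSidedIdeal.mem_comp _ _ _ h₄) (TwoSidedIdeal.mem_comp _ _ _ h₅)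

end

end TriCat

/-! ### The triangular matrix category is Hom-finite and Krull–Schmidt -/

theorem isZero_left_of_biprod {C : Type u} [Category.{v} C] [Preadditive C]
    [HasBinaryBiproducts C] {X Y : C} (h : IsZero (X ⊞ Y)) : IsZero X := by
  rw [IsZero.iff_id_eq_zero, ← biprod.inl_fst (X := X) (Y := Y), h.eq_of_tgt biprod.inl 0,
    zero_comp]

theorem isZero_right_of_biprod {C : Type u} [Category.{v} C] [Preadditive C]
    [HasBinaryBiproducts C] {X Y : C} (h : IsZero (X ⊞ Y)) : IsZero Y := by
  rw [IsZero.iff_id_eq_zero, ← biprod.inr_snd (X := X) (Y := Y), h.eq_of_tgt biprod.inr 0,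
    zero_comp]

/-- The zero objects are the objects of the lowest term of a heredity chain. -/
theorem IsQuasiHereditary.zero_iff_isZero {C : Type u} [Category.{v} C] [Preadditive C]
    [HasFiniteBiproducts C] {K : Type w} [Field K] [Linear K C] {B : ℕ → ObjectProperty C}
    (h : IsQuasiHereditary K B) (hB : IsAdditivelyClosed (B 0)) (X : C) :
    B 0 X ↔ IsZero X := by
  constructor
  · intro hX
    have : 𝟙 X ∈ (factorIdeal (B 0) (h.filtration.additive 0)).hom X X :=
      mem_factorIdeal_of_left hX _
    rw [h.heredityChain.zero] at this
    exact (IsZero.iff_id_eq_zero X).2 this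
  · intro hX
    obtain ⟨Z, hZ, hZ'⟩ := hB.exists_zero
    exact hB.of_iso _ _ (hZ'.iso hX) hZ

theorem isLocalRing_of_surjective {R S : Type*} [Ring R] [Ring S] [IsLocalRing R] [Nontrivial S]
    (φ : R →+* S) (hφ : Function.Surjective φ) : IsLocalRing S where
  isUnit_or_isUnit_of_add_one {a b} h := by
    obtain ⟨x, rfl⟩ := hφ a
    have hb : b = φ (1 - x) := by rw [map_sub, map_one, ← h, add_sub_cancel_left]
    rw [hb]
    exact (IsLocalRing.isUnit_or_isUnit_of_add_one (add_sub_cancel x 1)).imp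
      (fun h => h.map φ) (fun h => h.map φ)

namespace TriCat

variable {K : Type w} [Field K]
  {𝒯 : Type u₁} [Category.{v} 𝒯] [Preadditive 𝒯] [Linear K 𝒯]
  {𝒰 : Type u₂} [Category.{v} 𝒰] [Preadditive 𝒰] [Linear K 𝒰]
  {M : TensorCat K 𝒰 𝒯ᵒᵖ ⥤ ModuleCat.{v} K}

theorem hom_ext {X Y : TriCat M} {p q : X ⟶ Y} (h₁ : p.1 = q.1) (h₂ : p.2.1 = q.2.1)
    (h₃ : p.2.2 = q.2.2) : p = q :=
  Prod.ext h₁ (Prod.ext h₂ h₃)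

variable [M.Additive]

theorem eq_of_isZero_left {T : 𝒯} {U : 𝒰} (hU : IsZero U) (m m' : M.obj ⟨U, op T⟩) : m = m' :=
  (eq_zero_of_isZero_left hU m).trans (eq_zero_of_isZero_left hU m').symm

theorem eq_of_isZero_right {T : 𝒯} {U : 𝒰} (hT : IsZero T) (m m' : M.obj ⟨U, op T⟩) : m = m' :=
  (eq_zero_of_isZero_right hT m).trans (eq_zero_of_isZero_right hT m').symm

/-- Over a zero `𝒰`-entry the other matrix entries vanish, so `End X.t` maps onto `End X`. -/
theorem isLocalRing_of_fst {X : TriCat M} (hX : IsZero X.u) [IsLocalRing (End X.t)] :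
    IsLocalRing (End X) := by
  let φ : End X.t →+* End X :=
    { toFun f := mkHom f 0 0
      map_one' := hom_ext rfl rfl (hX.eq_of_src _ _)
      map_mul' f g := hom_ext rfl (eq_zero_of_isZero_left hX _).symm (hX.eq_of_src _ _)
      map_zero' := rfl
      map_add' f g := hom_ext rfl (add_zero _).symm (add_zero _).symm }
  have : Nontrivial (End X) := by
    obtain ⟨f, g, hfg⟩ := exists_pair_ne (End X.t)
    exact ⟨φ f, φ g, fun h => hfg (congrArg Prod.fst h)⟩
  exact isLocalRing_of_surjective φ fun p =>
    ⟨p.1, hom_ext rfl (eq_zero_of_isZero_left hX _).symm (hX.eq_of_src _ _)⟩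

theorem isLocalRing_of_snd {X : TriCat M} (hX : IsZero X.t) [IsLocalRing (End X.u)] :
    IsLocalRing (End X) := by
  let φ : End X.u →+* End X :=
    { toFun f := mkHom 0 0 f
      map_one' := hom_ext (hX.eq_of_src _ _) rfl rfl
      map_mul' f g := hom_ext (hX.eq_of_src _ _) (eq_zero_of_isZero_right hX _).symm rfl
      map_zero' := rfl
      map_add' f g := hom_ext (add_zero _).symm (add_zero _).symm rfl }
  have : Nontrivial (End X) := by
    obtain ⟨f, g, hfg⟩ := exists_pair_ne (End X.u)
    exact ⟨φ f, φ g, fun h => hfg (congrArg (fun p : X ⟶ X => p.2.2) h)⟩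
  exact isLocalRing_of_surjective φ fun p =>
    ⟨p.2.2, hom_ext (hX.eq_of_src _ _) (eq_zero_of_isZero_right hX _).symm rfl⟩

section

variable [M.Linear K]

theorem isHomFinite (hT : IsHomFinite 𝒯 K) (hU : IsHomFinite 𝒰 K)
    (hM : ∀ (U : 𝒰) (T : 𝒯), FiniteDimensional K (M.obj ⟨U, op T⟩)) : IsHomFinite (TriCat M) K := by
  intro X Y
  have := hT X.t Y.t
  have := hU X.u Y.u
  have := hM Y.u X.t
  exact inferInstanceAs (FiniteDimensional K ((X.t ⟶ Y.t) × M.obj ⟨Y.u, op X.t⟩ × (X.u ⟶ Y.u)))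

/-- The trace filtration of `M_T` runs from `0` at level `0` to `M_T` at level `n`, and every factor
is cyclic. Each step therefore adds at most the image of one finite-dimensional space `𝒰(E,U)`. -/
theorem finiteDimensional_obj [HasFiniteBiproducts 𝒰] {BU : ℕ → ObjectProperty 𝒰} (hBU : ∀ j, IsAdditiveSubcat (BU j))
    (h0 : ∀ U, BU 0 U → IsZero U) (hfin : IsHomFinite 𝒰 K) {n : ℕ} (hn : ∀ U, BU n U) {T : 𝒯}
    (hM : IsDeltaFiltered BU hBU (column M T)) (U : 𝒰) : FiniteDimensional K (M.obj ⟨U, op T⟩) := by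
  have key : ∀ j, ∃ S : Submodule K (M.obj ⟨U, op T⟩), FiniteDimensional K S ∧
      ∀ m ∈ columnTrace M (BU j) T U, m ∈ S := by
    intro j
    induction j with
    | zero =>
      refine ⟨⊥, inferInstance, fun m hm => ?_⟩
      obtain ⟨E, hE, m', s, rfl⟩ := (mem_columnTrace_iff (hBU 0)).1 hm
      rw [eq_zero_of_isZero_left (h0 _ hE) m', map_zero]
      exact zero_mem _
    | succ j ih =>
      obtain ⟨S, hS, hS'⟩ := ih
      obtain ⟨E, m₀, -, hgen, -⟩ := hM.exists_generator j
      let l : (E ⟶ U) →ₗ[K] M.obj ⟨U, op T⟩ :=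
        { toFun s := actU s m₀
          map_add' s t := actU_add s t _
          map_smul' a s := actU_smul a s _ }
      have := hfin E U
      refine ⟨S ⊔ LinearMap.range l, inferInstance, fun m hm => ?_⟩
      obtain ⟨s, hs⟩ := hgen U m hm
      rw [← sub_add_cancel m (l s)]
      exact add_mem (Submodule.mem_sup_left (hS' _ hs)) (Submodule.mem_sup_right ⟨s, rfl⟩)
  obtain ⟨S, hS, hS'⟩ := key n
  have : S = ⊤ := (Submodule.eq_top_iff').2 fun m => hS' m (mem_columnTrace_of_forall hn m)
  subst this
  exact Module.finite_def.2 ((Submodule.fg_top _).1 (Module.finite_def.1 hS))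

end

variable [HasFiniteBiproducts 𝒯] [HasFiniteBiproducts 𝒰]

/-- A decomposition projects to both corners: indecomposability kills one summand in the first, and
in the second both summands are already zero. -/
theorem indecomposable_of_fst {X : TriCat M} (hX : IsZero X.u) (h : Indecomposable X.t) :
    Indecomposable X := by
  refine ⟨fun h' => h.1 (isZero_iff.1 h').1, fun Y Z e => ?_⟩
  have hYZ : IsZero (Y.u ⊞ Z.u) :=
    hX.of_iso ((sndFunctor M).mapIso e ≪≫ (sndFunctor M).mapBiprod Y Z).symm
  exact (h.2 _ _ ((fstFunctor M).mapIso e ≪≫ (fstFunctor M).mapBiprod Y Z)).imp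
    (fun h => isZero_iff.2 ⟨h, isZero_left_of_biprod hYZ⟩)
    (fun h => isZero_iff.2 ⟨h, isZero_right_of_biprod hYZ⟩)

theorem indecomposable_of_snd {X : TriCat M} (hX : IsZero X.t) (h : Indecomposable X.u) :
    Indecomposable X := by
  refine ⟨fun h' => h.1 (isZero_iff.1 h').2, fun Y Z e => ?_⟩
  have hYZ : IsZero (Y.t ⊞ Z.t) :=
    hX.of_iso ((fstFunctor M).mapIso e ≪≫ (fstFunctor M).mapBiprod Y Z).symm
  exact (h.2 _ _ ((sndFunctor M).mapIso e ≪≫ (sndFunctor M).mapBiprod Y Z)).imp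
    (fun h => isZero_iff.2 ⟨isZero_left_of_biprod hYZ, h⟩)
    (fun h => isZero_iff.2 ⟨isZero_right_of_biprod hYZ, h⟩)

/-- Objects are pairs with no gluing data, so `X` is the direct sum of the objects obtained by
placing the summands of each diagonal entry next to a zero object. -/
theorem isKrullSchmidt (hT : IsKrullSchmidt 𝒯) (hU : IsKrullSchmidt 𝒰) :
    IsKrullSchmidt (TriCat M) := by
  intro X
  obtain ⟨a, E, hE, ⟨e⟩⟩ := hT X.t
  obtain ⟨b, E', hE', ⟨e'⟩⟩ := hU X.u
  have : HasZeroObject 𝒯 := hasZeroObject_of_hasFiniteBiproducts 𝒯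
  have : HasZeroObject 𝒰 := hasZeroObject_of_hasFiniteBiproducts 𝒰
  open scoped ZeroObject in
  let F : Fin a ⊕ Fin b → TriCat M := Sum.elim (fun i => ⟨E i, 0⟩) (fun i => ⟨0, E' i⟩)
  have hF : ∀ i, Indecomposable (F i) ∧ IsLocalRing (End (F i)) := by
    rintro (i | i)
    · have : IsLocalRing (End (F (Sum.inl i)).t) := (hE i).2
      exact ⟨indecomposable_of_fst (isZero_zero _) (hE i).1, isLocalRing_of_fst (isZero_zero _)⟩
    · have : IsLocalRing (End (F (Sum.inr i)).u) := (hE' i).2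
      exact ⟨indecomposable_of_snd (isZero_zero _) (hE' i).1, isLocalRing_of_snd (isZero_zero _)⟩
  let c : Bicone F :=
    { pt := X
      π := fun i => match i with
        | Sum.inl i => mkHom (e.hom ≫ biproduct.π E i) 0 0
        | Sum.inr i => mkHom 0 0 (e'.hom ≫ biproduct.π E' i)
      ι := fun i => match i with
        | Sum.inl i => mkHom (biproduct.ι E i ≫ e.inv) 0 0
        | Sum.inr i => mkHom 0 0 (biproduct.ι E' i ≫ e'.inv)
      ι_π := by
        rintro (i | i) (j | j)
        · by_cases hij : i = j
          · subst hij
            rw [dif_pos rfl]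
            exact hom_ext (show (biproduct.ι E i ≫ e.inv) ≫ e.hom ≫ biproduct.π E i = 𝟙 (E i) by
              simp) (eq_of_isZero_left (isZero_zero 𝒰) _ _) ((isZero_zero 𝒰).eq_of_src _ _)
          · rw [dif_neg (by simpa using hij)]
            exact hom_ext (show (biproduct.ι E i ≫ e.inv) ≫ e.hom ≫ biproduct.π E j = 0 by
              simp [biproduct.ι_π_ne _ hij]) (eq_of_isZero_left (isZero_zero 𝒰) _ _)
              ((isZero_zero 𝒰).eq_of_src _ _)
        · rw [dif_neg (by simp)]
          -- This is the one direction where morphisms between the two kinds of summands may be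
          -- nonzero; the composite vanishes because both matrices have zero lower left entry.
          refine hom_ext ((isZero_zero 𝒯).eq_of_tgt _ _) ?_ ((isZero_zero 𝒰).eq_of_src _ _)
          change actT _ 0 + actU _ 0 = 0
          rw [map_zero, map_zero, add_zero]
        · rw [dif_neg (by simp)]
          exact hom_ext ((isZero_zero 𝒯).eq_of_src _ _)
            (eq_of_isZero_right (isZero_zero 𝒯) _ _) ((isZero_zero 𝒰).eq_of_tgt _ _)
        · by_cases hij : i = j
          · subst hij
            rw [dif_pos rfl]
            exact hom_ext ((isZero_zero 𝒯).eq_of_src _ _) (eq_of_isZero_right (isZero_zero 𝒯) _ _)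
              (show (biproduct.ι E' i ≫ e'.inv) ≫ e'.hom ≫ biproduct.π E' i = 𝟙 (E' i) by simp)
          · rw [dif_neg (by simpa using hij)]
            exact hom_ext ((isZero_zero 𝒯).eq_of_src _ _) (eq_of_isZero_right (isZero_zero 𝒯) _ _)
              (show (biproduct.ι E' i ≫ e'.inv) ≫ e'.hom ≫ biproduct.π E' j = 0 by
                simp [biproduct.ι_π_ne _ hij]) }
  have hc : ∑ i, c.π i ≫ c.ι i = 𝟙 c.pt := by
    have h₁ : ∀ i, c.π (Sum.inl i) ≫ c.ι (Sum.inl i) =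
        (mkHom (e.hom ≫ (biproduct.π E i ≫ biproduct.ι E i) ≫ e.inv) 0 0 : X ⟶ X) := by
      intro i
      refine hom_ext (show (e.hom ≫ biproduct.π E i) ≫ biproduct.ι E i ≫ e.inv = _ by
        simp [mkHom]) ?_ zero_comp
      change actT _ 0 + actU _ 0 = 0
      rw [map_zero, map_zero, add_zero]
    have h₂ : ∀ i, c.π (Sum.inr i) ≫ c.ι (Sum.inr i) =
        (mkHom 0 0 (e'.hom ≫ (biproduct.π E' i ≫ biproduct.ι E' i) ≫ e'.inv) : X ⟶ X) := by
      intro i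
      refine hom_ext zero_comp ?_ (show (e'.hom ≫ biproduct.π E' i) ≫ biproduct.ι E' i ≫ e'.inv = _
        by simp [mkHom])
      change actT _ 0 + actU _ 0 = 0
      rw [map_zero, map_zero, add_zero]
    rw [Fintype.sum_sum_type]
    simp_rw [h₁, h₂]
    rw [mkHom_sum, mkHom_sum, ← Preadditive.comp_sum, ← Preadditive.comp_sum,
      ← Preadditive.sum_comp, ← Preadditive.sum_comp, biproduct.total, biproduct.total, mkHom_add]
    simp [id_eq, c]
  exact ⟨a + b, F ∘ finSumFinEquiv.symm, fun i => hF _,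
    ⟨biproduct.uniqueUpToIso F (isBilimitOfTotal c hc) ≪≫
      (biproduct.reindex finSumFinEquiv.symm F).symm⟩⟩

end TriCat

end QHCat

/-! ### Quasi-heredity of the triangular matrix category -/

theorem mainTheorem1 {K : Type w} [Field K]
    {𝒯 : Type u₁} [Category.{v} 𝒯] [Preadditive 𝒯] [Linear K 𝒯] [HasFiniteBiproducts 𝒯]
    {𝒰 : Type u₂} [Category.{v} 𝒰] [Preadditive 𝒰] [Linear K 𝒰] [HasFiniteBiproducts 𝒰]
    (n : ℕ) (BU : ℕ → ObjectProperty 𝒰) (BT : ℕ → ObjectProperty 𝒯)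
    (hU : QHCat.IsQuasiHereditary K BU) (hUclosed : ∀ j, QHCat.IsAdditivelyClosed (BU j))
    (hUfinite : ∀ j, n ≤ j → ∀ U : 𝒰, BU j U)
    (hT : QHCat.IsQuasiHereditary K BT) (hTclosed : ∀ j, QHCat.IsAdditivelyClosed (BT j))
    (M : QHCat.TensorCat K 𝒰 𝒯ᵒᵖ ⥤ ModuleCat.{v} K) [M.Additive] [M.Linear K]
    (hM : ∀ T : 𝒯, QHCat.IsDeltaFiltered BU hU.filtration.additive (QHCat.TriCat.column M T)) :
    QHCat.IsQuasiHereditary K (QHCat.TriCat.filtration M n BT BU) ∧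
      ∀ j, QHCat.IsAdditivelyClosed (QHCat.TriCat.filtration M n BT BU j) := by
  have hT0 := hT.zero_iff_isZero (hTclosed 0)
  have hU0 := hU.zero_iff_isZero (hUclosed 0)
  rw [QHCat.TriCat.filtration_eq_diag n hT0 hU0 hUfinite]
  have hclosed : ∀ j, QHCat.IsAdditivelyClosed (QHCat.TriCat.diag M (BT (j - n)) (BU j)) :=
    fun j => QHCat.TriCat.isAdditivelyClosed_diag (hTclosed _) (hUclosed j)
  -- The dichotomy on which the matrix description of the ideals rests; at `j = n` both alternatives
  -- hold.
  have h0 : ∀ j, (∀ U, BU j U) ∨ ∀ T, BT (j - n) T → IsZero T := by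
    intro j
    rcases le_total n j with h | h
    · exact Or.inl (hUfinite j h)
    · rw [Nat.sub_eq_zero_of_le h]
      exact Or.inr fun T => (hT0 T).1
  have hTmono : ∀ {j k : ℕ}, j ≤ k → ∀ T, BT j T → BT k T := fun {j k} hjk T hj => by
    induction hjk with
    | refl => exact hj
    | step _ ih => exact hT.filtration.mono _ _ ih
  have hUmono : ∀ {j k : ℕ}, j ≤ k → ∀ U, BU j U → BU k U := fun {j k} hjk U hj => by
    induction hjk with
    | refl => exact hj
    | step _ ih => exact hU.filtration.mono _ _ ih
  refine ⟨⟨QHCat.TriCat.isHomFinite hT.homFinite hU.homFinite fun U T =>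
      QHCat.TriCat.finiteDimensional_obj hU.filtration.additive (fun U => (hU0 U).1) hU.homFinite
        (hUfinite n le_rfl) (hM T) U,
    QHCat.TriCat.isKrullSchmidt hT.krullSchmidt hU.krullSchmidt,
    ⟨fun j => (hclosed j).toIsAdditiveSubcat, fun j X hX =>
      ⟨hTmono (by omega) _ hX.1, hUmono (by omega) _ hX.2⟩, fun X => ?_⟩,
    ⟨fun X Y => ?_, ?_, fun X Y f => ?_, fun j => ?_⟩⟩, hclosed⟩
  · obtain ⟨j, hj⟩ := hT.filtration.exhaustive X.t
    -- The shift by `n` reaches `𝒯_j` and makes the `𝒰`-entry unrestricted.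
    refine ⟨j + n, ?_, hUfinite _ (by omega) _⟩
    rwa [Nat.add_sub_cancel]
  · refine (AddSubgroup.eq_bot_iff_forall _).2 ?_
    rintro _ ⟨Z, ⟨hZ, hZ'⟩, r, s, rfl⟩
    rw [Nat.zero_sub] at hZ
    have hZ0 : IsZero Z := QHCat.TriCat.isZero_iff.2 ⟨(hT0 _).1 hZ, (hU0 _).1 hZ'⟩
    rw [hZ0.eq_of_tgt r 0, zero_comp]
  · rintro j X Y _ ⟨Z, hZ, r, s, rfl⟩
    exact ⟨Z, ⟨hTmono (by omega) _ hZ.1, hUmono (by omega) _ hZ.2⟩, r, s, rfl⟩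
  · obtain ⟨j, hj⟩ := hT.filtration.exhaustive X.t
    refine ⟨j + n, QHCat.mem_factorIdeal_of_left ⟨?_, hUfinite _ (by omega) _⟩ f⟩
    rwa [Nat.add_sub_cancel]
  · have hI := fun {X Y : QHCat.TriCat M} (p : X ⟶ Y) =>
      QHCat.TriCat.mem_factorIdeal_diag_iff (hT.filtration.additive (j - n))
        (hU.filtration.additive j) (hclosed j).toIsAdditiveSubcat (h0 j) p
    refine QHCat.isHeredity_factorIdeal (fun X Y p hX hY hp => ?_) fun X => ?_
    · refine (hI p).2 ⟨?_, ?_, ?_⟩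
      -- For `n ≤ j` the index satisfies `j + 1 - n = (j - n) + 1`, so the heredity chain of `𝒯`
      -- advances one step. For `j < n` both indices are `0`, and membership is immediate.
      · rcases le_or_gt n j with h | h
        · have hX1 := hX.1
          have hY1 := hY.1
          rw [Nat.sub_add_comm h] at hX1 hY1
          exact QHCat.mem_of_isRadicalMod (hT.heredityChain.heredity (j - n)) _ hX1 hY1
            (QHCat.TriCat.isRadicalMod_fst _ _ hp)
        · have hX1 := hX.1
          rw [show j + 1 - n = j - n by omega] at hX1
          exact QHCat.mem_factorIdeal_of_left hX1 _
      · rcases le_or_gt n j with h | h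
        · exact QHCat.TriCat.mem_columnTrace_of_forall (hUfinite j h) _
        · have hX1 := hX.1
          rw [Nat.sub_eq_zero_of_le h, hT0] at hX1
          rw [QHCat.TriCat.eq_zero_of_isZero_right hX1 p.2.1]
          exact zero_mem _
      · exact QHCat.mem_of_isRadicalMod (hU.heredityChain.heredity j) _ hX.2 hY.2
          (QHCat.TriCat.isRadicalMod_snd _ _ hp)
    · have hM' := (hM X.t).exists_generator j
      have hU' := QHCat.TwoSidedIdeal.IsProjectiveMod.of_isHeredity _ _
        (hU.heredityChain.heredity j) X.u
      refine QHCat.TriCat.isProjectiveMod_diag (hT.filtration.additive _)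
        (hT.filtration.additive _) (hU.filtration.additive _) (hU.filtration.additive _) _ _
        X ?_ hU' hM'
      -- For `j < n` both levels have zero `𝒯`-part; from `j = n` on, both have the full `𝒰`-part
      -- and `𝒯` supplies the generator.
      rcases le_or_gt n j with h | h
      · refine Or.inl ⟨hUfinite _ h, hUfinite _ (by omega), ?_⟩
        have hT' := QHCat.TwoSidedIdeal.IsProjectiveMod.of_isHeredity _ _
          (hT.heredityChain.heredity (j - n)) X.t
        simp only [← Nat.sub_add_comm h] at hT'
        exact hT'
      · refine Or.inr ⟨fun T hT' => ?_, fun T hT' => ?_⟩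
        · rwa [Nat.sub_eq_zero_of_le h.le, hT0] at hT'
        · rwa [Nat.sub_eq_zero_of_le h, hT0] at hT'
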